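/- Let $$\Pi=\langle u,v\mid u^3=v^7=(uv^2)^2\rangle,\qquad \overline\Pi=\langle u,v\mid u^3=v^7=(uv^2)^2=1\rangle,\qquad \Delta_{(2,3,7)}=\langle a,b\mid a^2=b^3=(ab)^7=1\rangle,$$ and let $\pi_1(S_3)=\langle a_1,b_1,a_2,b_2,a_3,b_3\mid [a_1,b_1][a_2,b_2][a_3,b_3]=1\rangle$ be the fundamental group of the closed orientable surface $S_3$ of genus $3$. A group $E$ is a $\mathbb Z$-central extension of a group $G$ if there is a short exact sequence $1\to\mathbb Z\to E\to G\to 1$ in which the image of $\mathbb Z$ is contained in the centre of $E$; it is virtually such an extension if some subgroup of finite index in $E$ is one. Then $\Pi$ is virtually a $\mathbb Z$-central extension of $\pi_1(S_3)$. More precisely: 1. The natural projection $p:\Pi\to\overline\Pi$, $u\mapsto u$, $v\mapsto v$, is a $\mathbb Z$-central extension whose kernel is infinite cyclic, generated by $u^3$, and the centre of $\Pi$ is $\langle u^3\rangle$. 2. There is an isomorphism $\varphi:\Delta_{(2,3,7)}\to\overline\Pi$ with $\varphi(a)=uv^2$ and $\varphi(b)=u$. 3. There is a surjective homomorphism $f:\Delta_{(2,3,7)}\to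 \mathrm{PSL}(2,\mathbb Z/7\mathbb Z)$ with $\ker f\cong\pi_1(S_3)$ such that the preimage $H=(\varphi^{-1}\circ p)^{-1}(\ker f)$ has finite index in $\Pi$, and $\varphi^{-1}\circ p$ restricts to a $\mathbb Z$-central extension $1\to\langle u^3\rangle\to H\to\ker f\to 1$. -/

import Mathlib

/-- A group extension `1 → N → E → G → 1` is central if the image of `N` lies in the centre
of `E`. -/
def GroupExtension.IsCentral {N E G : Type*} [Group N] [Group E] [Group G]
    (S : GroupExtension N E G) : Prop :=
  S.inl.range ≤ Subgroup.center E

/-- `E` is a `ℤ`-central extension of `G`: there is a short exact sequence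
`1 → ℤ → E → G → 1` with central kernel. -/
def IsZCentralExtension (E G : Type*) [Group E] [Group G] : Prop :=
  ∃ S : GroupExtension (Multiplicative ℤ) E G, S.IsCentral

/-- `E` is virtually a `ℤ`-central extension of `G`: some finite-index subgroup of `E` is a
`ℤ`-central extension of `G`. -/
def IsVirtuallyZCentralExtension (E G : Type*) [Group E] [Group G] : Prop :=
  ∃ H : Subgroup E, H.FiniteIndex ∧ IsZCentralExtension H G

/-- The (ordinary, orientation-preserving) triangle group
`⟨a, b | a ^ l = b ^ m = (a b) ^ n = 1⟩`, with generators `a = of 0` and `b = of 1`. -/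
abbrev TriangleGroup (l m n : ℕ) : Type :=
  PresentedGroup (α := Fin 2)
    {FreeGroup.of 0 ^ l, FreeGroup.of 1 ^ m, (FreeGroup.of 0 * FreeGroup.of 1) ^ n}

/-- The fundamental group of the closed orientable surface of genus `g`, in its standard
presentation `⟨a₁, b₁, …, a_g, b_g | [a₁, b₁] ⋯ [a_g, b_g] = 1⟩`; the generator `a_i` is
`of (Sum.inl i)` and `b_i` is `of (Sum.inr i)`. -/
abbrev SurfaceGroup (g : ℕ) : Type :=
  PresentedGroup (α := Fin g ⊕ Fin g)
    {(List.ofFn fun i : Fin g =>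
      FreeGroup.of (Sum.inl i) * FreeGroup.of (Sum.inr i) *
        (FreeGroup.of (Sum.inl i))⁻¹ * (FreeGroup.of (Sum.inr i))⁻¹).prod}

namespace QuinticA6A2

/-- The group `⟨u, v | u ^ 3 = v ^ 7 = (u v ^ 2) ^ 2⟩`. -/
abbrev Pi : Type :=
  PresentedGroup (α := Fin 2)
    {FreeGroup.of 0 ^ 3 * (FreeGroup.of 1 ^ 7)⁻¹,
      FreeGroup.of 1 ^ 7 * ((FreeGroup.of 0 * FreeGroup.of 1 ^ 2) ^ 2)⁻¹}

/-- The group `⟨u, v | u ^ 3 = v ^ 7 = (u v ^ 2) ^ 2 = 1⟩`. -/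
abbrev PiBar : Type :=
  PresentedGroup (α := Fin 2)
    {FreeGroup.of 0 ^ 3, FreeGroup.of 1 ^ 7, (FreeGroup.of 0 * FreeGroup.of 1 ^ 2) ^ 2}

/-- The generator `u` of `Pi`. -/
def u : Pi := PresentedGroup.of 0

/-- The generator `v` of `Pi`. -/
def v : Pi := PresentedGroup.of 1

/-- The generator `u` of `PiBar`. -/
def uBar : PiBar := PresentedGroup.of 0

/-- The generator `v` of `PiBar`. -/
def vBar : PiBar := PresentedGroup.of 1

/-- The generator `a` of the `(2,3,7)` triangle group. -/
def a : TriangleGroup 2 3 7 := PresentedGroup.of 0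

/-- The generator `b` of the `(2,3,7)` triangle group. -/
def b : TriangleGroup 2 3 7 := PresentedGroup.of 1

end QuinticA6A2

/-! Put `c = a * b`. The (2,3,7) triangle group contains a (3,3,7) triangle group with index 8 (the
stabilizer of infinity on the projective line over the field with 7 elements), which contains a
(7,7,7) group with index 3, which in turn maps onto `ZMod 7` with kernel a genus 3 surface group.
Since 8 * 3 * 7 = 168 is the order of PSL(2,7), this kernel should be `proj.ker`.

Generators `tWord a c i` of the kernel are written down explicitly and define `embedding` on an
abstract group `SymSurfaceGroup`. Inducing its regular action through the tower gives `monodromy`;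
on one sheet the image of `embedding` acts by left translation, whence `embedding_injective`.
Conversely, `inCosets` writes every element as one of 168 representatives times an element of the
range, and only the trivial representative dies in PSL(2,7) (`ker_proj`). An explicit change of
generators, `cyclicEquivSurface`, reaches the standard presentation.

For the centre of `Pi`, the surface group is an HNN extension of a free group over cyclic subgroups,
so its centre is trivial; so is that of PSL(2,7), hence that of the triangle group. Thus the centre
of `Pi` lies in the kernel of `natProj`, which is generated by `u ^ 3`. An integral matrix
representation sending `u ^ 3` to a nontrivial transvection shows that this kernel is infinite
cyclic. The extension is then restricted to the preimage of `proj.ker`. -/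

/-- The homomorphism out of the `(2,3,7)` triangle group determined by two elements that satisfy
its relations. -/
def TriangleGroup.lift237 {H : Type*} [Group H] (x y : H) (hx : x ^ 2 = 1) (hy : y ^ 3 = 1)
    (hxy : (x * y) ^ 7 = 1) : TriangleGroup 2 3 7 →* H :=
  PresentedGroup.toGroup (f := ![x, y]) (by
    rintro r (rfl | rfl | rfl) <;> simpa)

/-! ### Relations in the (2,3,7) triangle group -/

namespace KleinQuartic

open QuinticA6A2 Equiv

@[simp] theorem lift237_a {H : Type*} [Group H] {x y : H} (hx : x ^ 2 = 1) (hy : y ^ 3 = 1)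
    (hxy : (x * y) ^ 7 = 1) : TriangleGroup.lift237 x y hx hy hxy a = x :=
  PresentedGroup.toGroup.of _

@[simp] theorem lift237_b {H : Type*} [Group H] {x y : H} (hx : x ^ 2 = 1) (hy : y ^ 3 = 1)
    (hxy : (x * y) ^ 7 = 1) : TriangleGroup.lift237 x y hx hy hxy b = y :=
  PresentedGroup.toGroup.of _

theorem a_sq : a ^ 2 = 1 :=
  PresentedGroup.one_of_mem (rels := {FreeGroup.of (0 : Fin 2) ^ 2, FreeGroup.of 1 ^ 3,
    (FreeGroup.of 0 * FreeGroup.of 1) ^ 7}) (by simp)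

theorem b_cube : b ^ 3 = 1 :=
  PresentedGroup.one_of_mem (rels := {FreeGroup.of (0 : Fin 2) ^ 2, FreeGroup.of 1 ^ 3,
    (FreeGroup.of 0 * FreeGroup.of 1) ^ 7}) (by simp)

/-- The generator of order seven of the `(2,3,7)` triangle group. -/
def c : TriangleGroup 2 3 7 := a * b

theorem c_pow_seven : c ^ 7 = 1 :=
  PresentedGroup.one_of_mem (rels := {FreeGroup.of (0 : Fin 2) ^ 2, FreeGroup.of 1 ^ 3,
    (FreeGroup.of 0 * FreeGroup.of 1) ^ 7}) (by simp)

theorem a_mul_a : a * a = 1 := by rw [← sq, a_sq]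

theorem a_inv : a⁻¹ = a := inv_eq_of_mul_eq_one_left a_mul_a

theorem b_eq : b = a * c := by rw [c, ← mul_assoc, a_mul_a, one_mul]

/-! ### A symmetric presentation of the genus three surface group -/

/-- The relators of the presentation with seven generators permuted cyclically by the deck
transformations of the Klein quartic over a sphere with three cone points of order seven. -/
def cyclicRels : Set (FreeGroup (ZMod 7)) :=
  {FreeGroup.of 5 * FreeGroup.of 3 * FreeGroup.of 1 * FreeGroup.of 6 * FreeGroup.of 4 *
      FreeGroup.of 2 * FreeGroup.of 0,
    FreeGroup.of 5 * FreeGroup.of 2 * FreeGroup.of 6 * FreeGroup.of 3 * FreeGroup.of 0 *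
      FreeGroup.of 4 * FreeGroup.of 1}

/-- The group `⟨t₀, …, t₆ | t₅t₃t₁t₆t₄t₂t₀ = t₅t₂t₆t₃t₀t₄t₁ = 1⟩`. -/
abbrev SymSurfaceGroup : Type := PresentedGroup cyclicRels

/-- The generators of `SymSurfaceGroup`. -/
def t (i : ZMod 7) : SymSurfaceGroup := PresentedGroup.of i

theorem t_rel_two : t 5 * t 3 * t 1 * t 6 * t 4 * t 2 * t 0 = 1 :=
  PresentedGroup.one_of_mem (rels := cyclicRels) (Or.inl rfl)

theorem t_rel_three : t 5 * t 2 * t 6 * t 3 * t 0 * t 4 * t 1 = 1 :=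
  PresentedGroup.one_of_mem (rels := cyclicRels) (Or.inr rfl)

/-- The homomorphism out of `SymSurfaceGroup` determined by seven elements satisfying its relations. -/
def SymSurfaceGroup.lift {H : Type*} [Group H] (s : ZMod 7 → H)
    (h₂ : s 5 * s 3 * s 1 * s 6 * s 4 * s 2 * s 0 = 1)
    (h₃ : s 5 * s 2 * s 6 * s 3 * s 0 * s 4 * s 1 = 1) : SymSurfaceGroup →* H :=
  PresentedGroup.toGroup (f := s) (by
    rintro r (rfl | rfl) <;> simpa)

@[simp] theorem SymSurfaceGroup.lift_t {H : Type*} [Group H] {s : ZMod 7 → H}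
    (h₂ : s 5 * s 3 * s 1 * s 6 * s 4 * s 2 * s 0 = 1)
    (h₃ : s 5 * s 2 * s 6 * s 3 * s 0 * s 4 * s 1 = 1) (i : ZMod 7) :
    SymSurfaceGroup.lift s h₂ h₃ (t i) = s i :=
  PresentedGroup.toGroup.of _

/-! ### The induced action of the triangle group -/

section Shear

variable {Y : Type*}

/-- The rotation of order seven of `ZMod 7 × SymSurfaceGroup` that shifts the first coordinate. -/
def shift : Perm (ZMod 7 × SymSurfaceGroup) := prodShear (Equiv.addRight 1) fun _ => 1

/-- The double shift of the first coordinate, twisted by the generators `t i`. -/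
def twist : Perm (ZMod 7 × SymSurfaceGroup) :=
  prodShear (Equiv.addRight 2) fun i => Equiv.mulLeft (t i)

theorem shift_apply (i : ZMod 7) (g : SymSurfaceGroup) : shift (i, g) = (i + 1, g) := rfl

theorem twist_apply (i : ZMod 7) (g : SymSurfaceGroup) : twist (i, g) = (i + 2, t i * g) := rfl

theorem shift_pow_apply (n : ℕ) (i : ZMod 7) (g : SymSurfaceGroup) :
    (shift ^ n) (i, g) = (i + n, g) := by
  induction n with
  | zero => simp
  | succ n ih => rw [pow_succ', Perm.mul_apply, ih, shift_apply]; push_cast; rw [add_assoc]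

theorem shift_pow_seven : shift ^ 7 = 1 := by
  ext1 ⟨i, g⟩
  rw [shift_pow_apply]
  exact Prod.ext (by simpa using congrArg (i + ·) (by decide : ((7 : ℕ) : ZMod 7) = 0)) rfl

/-- A permutation power that is trivial on a set meeting every orbit is trivial. -/
theorem pow_eq_one_of_orbit {σ : Perm Y} {m : ℕ} (s : Set Y)
    (hs : ∀ y ∈ s, (σ ^ m) y = y) (horb : ∀ y, ∃ n : ℕ, (σ ^ n) y ∈ s) : σ ^ m = 1 := by
  ext1 y
  obtain ⟨n, hn⟩ := horb y
  have := hs _ hn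
  rw [← Perm.mul_apply, ← pow_add, add_comm, pow_add, Perm.mul_apply] at this
  exact (σ ^ n).injective this

theorem fst_pow_apply {σ : Perm (ZMod 7 × SymSurfaceGroup)} {k : ZMod 7}
    (h : ∀ y, (σ y).1 = y.1 + k) (n : ℕ) (y : ZMod 7 × SymSurfaceGroup) :
    ((σ ^ n) y).1 = y.1 + n * k := by
  induction n with
  | zero => simp
  | succ n ih => rw [pow_succ', Perm.mul_apply, h, ih]; push_cast; ring

theorem twist_pow_seven : twist ^ 7 = 1 := by
  -- Each application adds 2 to the index and 3 * 2 = -1, so 3i applications lead from i to 0. A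
  -- full turn from 0 multiplies by the first relator.
  refine pow_eq_one_of_orbit {y | y.1 = 0} ?_ fun y => ⟨(3 * y.1).val, ?_⟩
  · rintro ⟨i, g⟩ (rfl : i = 0)
    simp only [pow_succ, pow_zero, one_mul, Perm.mul_apply, twist_apply,
      show (0 : ZMod 7) + 2 = 2 from rfl, show (2 : ZMod 7) + 2 = 4 from rfl,
      show (4 : ZMod 7) + 2 = 6 from rfl, show (6 : ZMod 7) + 2 = 1 from rfl,
      show (1 : ZMod 7) + 2 = 3 from rfl, show (3 : ZMod 7) + 2 = 5 from rfl,
      show (5 : ZMod 7) + 2 = 0 from rfl, ← mul_assoc, t_rel_two]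
  · rw [Set.mem_ofPred_eq, fst_pow_apply (k := 2) (fun _ => rfl), ZMod.natCast_zmod_val]
    generalize y.1 = i
    revert i; decide

theorem twist_mul_shift_pow_seven : (twist * shift) ^ 7 = 1 := by
  -- Each application adds 3 and 2 * 3 = -1; a full turn from 0 multiplies by the second relator.
  refine pow_eq_one_of_orbit {y | y.1 = 0} ?_ fun y => ⟨(2 * y.1).val, ?_⟩
  · rintro ⟨i, g⟩ (rfl : i = 0)
    simp only [pow_succ, pow_zero, one_mul, Perm.mul_apply, twist_apply, shift_apply,
      show (0 : ZMod 7) + 1 = 1 from rfl, show (1 : ZMod 7) + 2 = 3 from rfl,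
      show (3 : ZMod 7) + 1 = 4 from rfl, show (4 : ZMod 7) + 2 = 6 from rfl,
      show (6 : ZMod 7) + 1 = 0 from rfl, show (0 : ZMod 7) + 2 = 2 from rfl,
      show (2 : ZMod 7) + 1 = 3 from rfl, show (3 : ZMod 7) + 2 = 5 from rfl,
      show (5 : ZMod 7) + 1 = 6 from rfl, show (6 : ZMod 7) + 2 = 1 from rfl,
      show (1 : ZMod 7) + 1 = 2 from rfl, show (2 : ZMod 7) + 2 = 4 from rfl,
      show (4 : ZMod 7) + 1 = 5 from rfl, show (5 : ZMod 7) + 2 = 0 from rfl,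
      ← mul_assoc, t_rel_three]
  · rw [Set.mem_ofPred_eq, fst_pow_apply (k := 3) (fun y => by
      change y.1 + 1 + 2 = _; rw [add_assoc]; rfl), ZMod.natCast_zmod_val]
    generalize y.1 = i
    revert i; decide

/-- The three rotations of order seven. -/
def rotation : ZMod 3 → Perm (ZMod 7 × SymSurfaceGroup) := ![shift, twist, (twist * shift)⁻¹]

theorem rotation_pow_seven (j : ZMod 3) : rotation j ^ 7 = 1 := by
  fin_cases j
  · exact shift_pow_seven
  · exact twist_pow_seven
  · exact (inv_pow _ _).trans (inv_eq_one.2 twist_mul_shift_pow_seven)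

/-- The generator of order seven of the `(3,3,7)` triangle group, acting. -/
def bigRotation : Perm (ZMod 3 × (ZMod 7 × SymSurfaceGroup)) := prodShear 1 rotation

/-- The permutation of order three that permutes the three rotations cyclically. -/
def cycle : Perm (ZMod 3 × (ZMod 7 × SymSurfaceGroup)) := prodShear (Equiv.addRight 1) fun _ => 1

theorem bigRotation_apply (j : ZMod 3) (z) : bigRotation (j, z) = (j, rotation j z) := rfl

theorem cycle_apply (j : ZMod 3) (z) : cycle (j, z) = (j + 1, z) := rfl

theorem bigRotation_pow_apply (n : ℕ) (j : ZMod 3) (z) :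
    (bigRotation ^ n) (j, z) = (j, (rotation j ^ n) z) := by
  induction n with
  | zero => simp
  | succ n ih => rw [pow_succ', Perm.mul_apply, ih, bigRotation_apply, pow_succ', Perm.mul_apply]

theorem bigRotation_pow_seven : bigRotation ^ 7 = 1 := by
  ext1 ⟨j, z⟩
  rw [bigRotation_pow_apply, rotation_pow_seven]; rfl

theorem cycle_pow_three : cycle ^ 3 = 1 := by
  ext1 ⟨j, z⟩
  change (j + 1 + 1 + 1, z) = (j, z)
  congr 1
  revert j; decide

theorem rotation_two_apply (z) : rotation 2 (twist (shift z)) = z :=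
  (twist * shift).symm_apply_apply z

theorem cycle_mul_bigRotation_pow_three : (cycle * bigRotation) ^ 3 = 1 := by
  refine pow_eq_one_of_orbit {y | y.1 = 0} ?_ ?_
  · rintro ⟨j, z⟩ (rfl : j = 0)
    change ((0 : ZMod 3) + 1 + 1 + 1, rotation 2 (twist (shift z))) = (0, z)
    rw [rotation_two_apply]; rfl
  · rintro ⟨j, z⟩
    fin_cases j
    · exact ⟨0, rfl⟩
    · exact ⟨2, show (1 : ZMod 3) + 1 + 1 = 0 from rfl⟩
    · exact ⟨1, show (2 : ZMod 3) + 1 = 0 from rfl⟩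

/-! ### Induction from the (3,3,7) to the (2,3,7) triangle group -/

/-- The involution `z ↦ -1/z` of the projective line over the field with seven elements, where
`0` stands for the point at infinity and `k + 1` for the point `k`. -/
def lineInvolution : Perm (Fin 8) :=
  Function.Involutive.toPerm ![1, 0, 7, 4, 3, 6, 5, 2] (by unfold Function.Involutive; decide)

/-- The translation `z ↦ z + 1` of the projective line over the field with seven elements. -/
def lineTranslation : Perm (Fin 8) where
  toFun := ![0, 2, 3, 4, 5, 6, 7, 1]
  invFun := ![0, 7, 1, 2, 3, 4, 5, 6]
  left_inv := by decide
  right_inv := by decide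

/-- The involution induced by `x, p`, elements of order seven and three with `(p * x) ^ 3 = 1`. -/
def inducedInvolution (x p : Perm Y) : Perm (Fin 8 × Y) :=
  -- Entry k is the factor left over when `a * rep a c k` is rewritten with the representative of
  -- the image point, `x` and `p` standing for `c` and `pWord a c`; see `InCosets.a_mul`. Points
  -- that are exchanged carry inverse entries.
  prodShear lineInvolution ![1, 1, x⁻¹, p, p⁻¹, (p * x)⁻¹, p * x, x]

/-- The translation induced by an element `x` of order seven. -/
def inducedTranslation (x : Perm Y) : Perm (Fin 8 × Y) :=
  prodShear lineTranslation ![x, 1, 1, 1, 1, 1, 1, 1]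

theorem inducedInvolution_sq (x p : Perm Y) : inducedInvolution x p ^ 2 = 1 := by
  ext1 ⟨k, y⟩
  rw [sq]
  fin_cases k <;>
    simp [inducedInvolution, lineInvolution, Function.Involutive.toPerm]

theorem inducedTranslation_pow_seven {x : Perm Y} (hx : x ^ 7 = 1) :
    inducedTranslation x ^ 7 = 1 := by
  ext1 ⟨k, y⟩
  have := Perm.congr_fun hx y
  simp only [pow_succ, pow_zero, one_mul, Perm.mul_apply, Perm.one_apply] at this ⊢
  fin_cases k <;>
    simp [inducedTranslation, lineTranslation, this]

theorem inducedInvolution_mul_inducedTranslation {x p : Perm Y} (hp : p ^ 3 = 1)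
    (hpx : (p * x) ^ 3 = 1) :
    (inducedInvolution x p * inducedTranslation x) ^ 3 = 1 := by
  ext1 ⟨k, y⟩
  have h₁ := Perm.congr_fun (inv_pow p 3 ▸ inv_eq_one.2 hp : p⁻¹ ^ 3 = 1) y
  have h₂ := Perm.congr_fun hpx y
  simp only [pow_succ, pow_zero, one_mul, Perm.mul_apply, Perm.one_apply, Perm.inv_def] at h₁ h₂ ⊢
  fin_cases k <;>
    simp [inducedInvolution, lineInvolution, Function.Involutive.toPerm,
      inducedTranslation, lineTranslation, h₁, h₂]

end Shear

/-- The monodromy action of the `(2,3,7)` triangle group on `168` copies of `SymSurfaceGroup`. -/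
def monodromy :
    TriangleGroup 2 3 7 →* Perm (Fin 8 × (ZMod 3 × (ZMod 7 × SymSurfaceGroup))) :=
  TriangleGroup.lift237 (inducedInvolution bigRotation cycle)
    (inducedInvolution bigRotation cycle * inducedTranslation bigRotation)
    (inducedInvolution_sq _ _)
    (inducedInvolution_mul_inducedTranslation cycle_pow_three cycle_mul_bigRotation_pow_three)
    (by rw [← mul_assoc, ← sq, inducedInvolution_sq, one_mul,
      inducedTranslation_pow_seven bigRotation_pow_seven])

theorem monodromy_a : monodromy a = inducedInvolution bigRotation cycle := lift237_a ..

theorem monodromy_c : monodromy c = inducedTranslation bigRotation := by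
  rw [c, map_mul, monodromy, lift237_a, lift237_b, ← mul_assoc, ← sq, inducedInvolution_sq,
    one_mul]

/-! ### The surface group inside the triangle group -/

section Words

variable {H : Type*} [Group H] (a c : H)

/-- A word of order three in the stabilizer of the point at infinity. -/
def pWord : H := a * c ^ 4 * a * c ^ 2 * a

/-- The conjugate of `c` by `pWord a c`. -/
def dWord : H := pWord a c ^ 2 * c * pWord a c

/-- The words that lift the generators `t i`. -/
def tWord (i : ZMod 7) : H := c ^ (12 - i.val) * dWord a c * c ^ i.val

variable {a c}

theorem mul_mul_eq_of_pow_three (ha : a * a = 1) (hac : (a * c) ^ 3 = 1) :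
    a * c * a = c⁻¹ * a * c⁻¹ := by
  have ha' : a⁻¹ = a := inv_eq_of_mul_eq_one_left ha
  have : (a * c * a) * (c * a * c) = 1 := by
    rw [← hac, pow_succ, sq]; group
  rw [eq_inv_of_mul_eq_one_left this, mul_inv_rev, mul_inv_rev, ha', mul_assoc]

theorem pow_conj_inv (g h : H) (n : ℕ) : (g⁻¹ * h * g) ^ n = g⁻¹ * h ^ n * g := by
  simpa using conj_pow (i := n) (a := g⁻¹) (b := h)

/-- `pWord a c` is the Schreier generator `(c ^ 3 * a)⁻¹ * a * (c ^ 2 * a)`, which is a conjugate of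
`(a * c)⁻¹`. -/
theorem pWord_pow_three (ha : a * a = 1) (hc : c ^ 7 = 1) (hac : (a * c) ^ 3 = 1) :
    pWord a c ^ 3 = 1 := by
  have ha' : a⁻¹ = a := inv_eq_of_mul_eq_one_left ha
  have h4 : c ^ 4 = (c ^ 3)⁻¹ := eq_inv_of_mul_eq_one_left (by rw [← pow_add, hc])
  have : pWord a c = (c ^ 2 * a)⁻¹ * (a * c)⁻¹ * (c ^ 2 * a) := by
    rw [pWord, h4, mul_inv_rev, mul_inv_rev, ha']; group
  rw [this, pow_conj_inv, inv_pow, hac]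
  group

theorem pWord_mul_eq (ha : a * a = 1) (hc : c ^ 7 = 1) (hac : (a * c) ^ 3 = 1) :
    pWord a c * c = (c ^ 4 * a)⁻¹ * (a * c) * (c ^ 4 * a) := by
  have ha' : a⁻¹ = a := inv_eq_of_mul_eq_one_left ha
  have h3 : c ^ 3 = (c ^ 4)⁻¹ := eq_inv_of_mul_eq_one_left (by rw [← pow_add, hc])
  have h5 : c ^ 5 = (c ^ 2)⁻¹ := eq_inv_of_mul_eq_one_left (by rw [← pow_add, hc])
  have h2 : a * c ^ 2 * a = c⁻¹ * (a * c ^ 5 * a) * c⁻¹ := by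
    calc a * c ^ 2 * a = (a * c * a) * a⁻¹ * a⁻¹ * (a * c * a) := by rw [sq]; group
      _ = (a * c * a) * (a * c * a) := by rw [ha', mul_assoc (a * c * a), ha, mul_one]
      _ = c⁻¹ * (a * (c ^ 2)⁻¹ * a) * c⁻¹ := by
        rw [mul_mul_eq_of_pow_three ha hac, sq]; group
      _ = _ := by rw [h5]
  calc pWord a c * c = a * c ^ 4 * (a * c ^ 2 * a) * c := by rw [pWord]; group
    _ = a * c ^ 3 * a * c ^ 5 * a := by rw [h2, pow_succ c 3]; group
    _ = _ := by rw [h3, mul_inv_rev, ha']; group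

theorem pWord_mul_pow_three (ha : a * a = 1) (hc : c ^ 7 = 1) (hac : (a * c) ^ 3 = 1) :
    (pWord a c * c) ^ 3 = 1 := by
  rw [pWord_mul_eq ha hc hac, pow_conj_inv, hac]
  group

theorem dWord_eq (hp : pWord a c ^ 3 = 1) : dWord a c = (pWord a c)⁻¹ * c * pWord a c := by
  rw [dWord, eq_inv_of_mul_eq_one_left (a := pWord a c ^ 2) (b := pWord a c)
    (by rw [← pow_succ, hp])]

/-- A rearrangement of `hpc`. Thus `c`, `dWord a c` and `(dWord a c * c)⁻¹` are conjugates of `c` by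
powers of `pWord a c`, and they generate the (7,7,7) group. -/
theorem dWord_mul_inv (hpc : (pWord a c * c) ^ 3 = 1) :
    (dWord a c * c)⁻¹ = pWord a c * c * (pWord a c)⁻¹ := by
  refine inv_eq_of_mul_eq_one_left ?_
  rw [← hpc, dWord, sq, pow_succ _ 2, sq]
  group

theorem dWord_pow_seven (hc : c ^ 7 = 1) (hp : pWord a c ^ 3 = 1) : dWord a c ^ 7 = 1 := by
  rw [dWord_eq hp, pow_conj_inv, hc]
  group

theorem dWord_mul_pow_seven (hc : c ^ 7 = 1)
    (hpc : (pWord a c * c) ^ 3 = 1) : (dWord a c * c) ^ 7 = 1 := by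
  rw [← inv_inj, ← inv_pow, dWord_mul_inv hpc, conj_pow, hc]
  group

/-- The exponent `12 - i.val` is -(i + 2) modulo 7, without truncation since `i.val ≤ 6`. So the
powers of `c` between consecutive factors cancel modulo 7, leaving seven copies of `dWord a c`. -/
theorem tWord_rel_two (hc : c ^ 7 = 1) (hd : dWord a c ^ 7 = 1) :
    tWord a c 5 * tWord a c 3 * tWord a c 1 * tWord a c 6 * tWord a c 4 * tWord a c 2 *
      tWord a c 0 = 1 := by
  change (c ^ 7 * dWord a c * c ^ 5) * (c ^ 9 * dWord a c * c ^ 3) *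
    (c ^ 11 * dWord a c * c ^ 1) * (c ^ 6 * dWord a c * c ^ 6) * (c ^ 8 * dWord a c * c ^ 4) *
    (c ^ 10 * dWord a c * c ^ 2) * (c ^ 12 * dWord a c * c ^ 0) = 1
  have h14 : c ^ 14 = 1 := by rw [show 14 = 7 * 2 from rfl, pow_mul, hc, one_pow]
  calc _ = c ^ 7 * dWord a c * c ^ 14 * dWord a c * c ^ 14 * dWord a c * c ^ 7 * dWord a c *
        c ^ 14 * dWord a c * c ^ 14 * dWord a c * c ^ 14 * dWord a c := by group
    _ = dWord a c ^ 7 := by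
      rw [h14, hc]; simp only [one_mul, mul_one, pow_succ, pow_zero]
    _ = 1 := hd

theorem tWord_rel_three (hc : c ^ 7 = 1) (hdc : (dWord a c * c) ^ 7 = 1) :
    tWord a c 5 * tWord a c 2 * tWord a c 6 * tWord a c 3 * tWord a c 0 * tWord a c 4 *
      tWord a c 1 = 1 := by
  change (c ^ 7 * dWord a c * c ^ 5) * (c ^ 10 * dWord a c * c ^ 2) *
    (c ^ 6 * dWord a c * c ^ 6) * (c ^ 9 * dWord a c * c ^ 3) * (c ^ 12 * dWord a c * c ^ 0) *
    (c ^ 8 * dWord a c * c ^ 4) * (c ^ 11 * dWord a c * c ^ 1) = 1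
  have h14 : c ^ 14 = 1 := by rw [show 14 = 7 * 2 from rfl, pow_mul, hc, one_pow]
  calc _ = c ^ 7 * (dWord a c * c) * c ^ 14 * (dWord a c * c) * c ^ 7 * (dWord a c * c) *
        c ^ 14 * (dWord a c * c) * c ^ 14 * (dWord a c * c) * c ^ 7 * (dWord a c * c) *
        c ^ 14 * (dWord a c * c) := by group
    _ = (dWord a c * c) ^ 7 := by
      rw [h14, hc]; simp only [one_mul, mul_one, pow_succ, pow_zero]
    _ = 1 := hdc

theorem map_pWord {H' : Type*} [Group H'] (f : H →* H') :
    f (pWord a c) = pWord (f a) (f c) := by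
  simp [pWord]

theorem map_tWord {H' : Type*} [Group H'] (f : H →* H') (i : ZMod 7) :
    f (tWord a c i) = tWord (f a) (f c) i := by
  simp [tWord, dWord, map_pWord]

end Words

theorem a_mul_c_pow_three : (a * c) ^ 3 = 1 := by rw [← b_eq, b_cube]

/-- The element `pWord a c` of the triangle group. -/
def p : TriangleGroup 2 3 7 := pWord a c

theorem p_pow_three : p ^ 3 = 1 := pWord_pow_three a_mul_a c_pow_seven a_mul_c_pow_three

theorem p_mul_c_pow_three : (p * c) ^ 3 = 1 :=
  pWord_mul_pow_three a_mul_a c_pow_seven a_mul_c_pow_three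

/-- The embedding of `SymSurfaceGroup` in the triangle group. -/
def embedding : SymSurfaceGroup →* TriangleGroup 2 3 7 :=
  SymSurfaceGroup.lift (tWord a c)
    (tWord_rel_two c_pow_seven (dWord_pow_seven c_pow_seven p_pow_three))
    (tWord_rel_three c_pow_seven
      (dWord_mul_pow_seven c_pow_seven p_mul_c_pow_three))

theorem embedding_t (i : ZMod 7) : embedding (t i) = tWord a c i := SymSurfaceGroup.lift_t ..

theorem inducedTranslation_zero {Y : Type*} (x : Perm Y) (y : Y) :
    inducedTranslation x (0, y) = (0, x y) := rfl

/-- Read from right to left, the word is a closed path on the line based at infinity, and the only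
nontrivial label that it meets is `q`. -/
theorem pWord_induced_apply {Y : Type*} (x q : Perm Y) (y : Y) :
    pWord (inducedInvolution x q) (inducedTranslation x) (0, y) = (0, q y) := by
  simp [pWord, inducedTranslation, inducedInvolution,
    lineTranslation, lineInvolution, pow_succ, Function.Involutive.toPerm]

theorem rotation_zero : rotation 0 = shift := rfl

theorem rotation_one : rotation 1 = twist := rfl

theorem cycle_sq_bigRotation_cycle_apply (z) :
    cycle (cycle (bigRotation (cycle (0, z)))) = (0, rotation 1 z) := by
  have h1 : (0 : ZMod 3) + 1 = 1 := by decide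
  have h0 : (1 : ZMod 3) + 1 + 1 = 0 := by decide
  rw [cycle_apply 0, h1, bigRotation_apply, cycle_apply 1, cycle_apply (1 + 1), h0]

theorem dWord_induced_apply (i : ZMod 7) (g : SymSurfaceGroup) :
    dWord (inducedInvolution bigRotation cycle) (inducedTranslation bigRotation) (0, 0, i, g) =
      (0, 0, i + 2, t i * g) := by
  rw [dWord, sq, Perm.mul_apply, Perm.mul_apply, Perm.mul_apply, pWord_induced_apply,
    inducedTranslation_zero, pWord_induced_apply, pWord_induced_apply,
    cycle_sq_bigRotation_cycle_apply, rotation_one, twist_apply]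

theorem inducedTranslation_pow_apply (n : ℕ) (i : ZMod 7) (g : SymSurfaceGroup) :
    (inducedTranslation bigRotation ^ n) (0, 0, i, g) = (0, 0, i + n, g) := by
  induction n with
  | zero => simp
  | succ n ih =>
    rw [pow_succ', Perm.mul_apply, ih, inducedTranslation_zero, bigRotation_apply,
      rotation_zero, shift_apply]
    push_cast; rw [add_assoc]

theorem monodromy_tWord_apply (i : ZMod 7) (g : SymSurfaceGroup) :
    monodromy (tWord a c i) (0, 0, 0, g) = (0, 0, 0, t i * g) := by
  rw [map_tWord, monodromy_a, monodromy_c, tWord, Perm.mul_apply, inducedTranslation_pow_apply,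
    Perm.mul_apply, zero_add, ZMod.natCast_zmod_val, dWord_induced_apply,
    inducedTranslation_pow_apply]
  congr 3
  revert i; decide

/-- The induced action contains the left regular action on the base sheet; faithfulness of the
latter makes `embedding` injective. -/
theorem monodromy_embedding_apply (h g : SymSurfaceGroup) :
    monodromy (embedding h) (0, 0, 0, g) = (0, 0, 0, h * g) := by
  obtain ⟨h, rfl⟩ := PresentedGroup.mk_surjective _ h
  induction h using FreeGroup.induction_on generalizing g with
  | C1 => simp
  | of i =>
    change monodromy (embedding (t i)) _ = (0, 0, 0, t i * g)
    rw [embedding_t, monodromy_tWord_apply]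
  | inv_of i ih =>
    rw [map_inv, map_inv, map_inv, Perm.inv_eq_iff_eq, ih, mul_inv_cancel_left]
  | mul x y hx hy => rw [map_mul, map_mul, map_mul, Perm.mul_apply, hy, hx, mul_assoc]

theorem embedding_injective : Function.Injective embedding := by
  refine (injective_iff_map_eq_one _).2 fun h hh => ?_
  have := monodromy_embedding_apply h 1
  rw [hh] at this
  simpa using this.symm

open scoped MatrixGroups

/-! ### The projection to `PSL(2, 7)` -/

/-- The matrix of `z ↦ -1/z`. -/
def matS : SL(2, ZMod 7) := ⟨!![0, -1; 1, 0], by decide⟩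

/-- The matrix of `z ↦ z + 1`. -/
def matT : SL(2, ZMod 7) := ⟨!![1, 1; 0, 1], by decide⟩

theorem coe_matS : (↑matS : Matrix (Fin 2) (Fin 2) (ZMod 7)) = !![0, -1; 1, 0] := rfl

/-- An entrywise form of being scalar, so that identities in PSL(2,7) become decidable. -/
theorem mem_center_iff_apply {A : SL(2, ZMod 7)} :
    A ∈ Subgroup.center SL(2, ZMod 7) ↔ A 0 1 = 0 ∧ A 1 0 = 0 ∧ A 0 0 = A 1 1 := by
  rw [Matrix.SpecialLinearGroup.mem_center_iff]
  constructor
  · rintro ⟨r, -, h⟩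
    simp [← h]
  · rintro ⟨h1, h2, h3⟩
    refine ⟨A 0 0, ?_, ?_⟩
    · have := A.2
      rw [Matrix.det_fin_two, h1, h2, ← h3] at this
      rw [Fintype.card_fin, sq]; simpa using this
    · ext i j
      fin_cases i <;> fin_cases j <;> simp [h1, h2, h3]

theorem mk_eq_one_iff {A : SL(2, ZMod 7)} :
    (QuotientGroup.mk A : PSL(2, ZMod 7)) = 1 ↔
      A 0 1 = 0 ∧ A 1 0 = 0 ∧ A 0 0 = A 1 1 := by
  rw [QuotientGroup.eq_one_iff, mem_center_iff_apply]

/-- The projection of the triangle group to `PSL(2, 7)`. -/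
def proj : TriangleGroup 2 3 7 →* PSL(2, ZMod 7) :=
  TriangleGroup.lift237 (QuotientGroup.mk' _ matS) (QuotientGroup.mk' _ (matS⁻¹ * matT))
    (by rw [← map_pow]; exact mk_eq_one_iff.2 (by decide +kernel))
    (by rw [← map_pow]; exact mk_eq_one_iff.2 (by decide +kernel))
    (by rw [← map_mul, ← map_pow]; exact mk_eq_one_iff.2 (by decide +kernel))

theorem proj_a : proj a = QuotientGroup.mk' _ matS := lift237_a ..

theorem proj_b : proj b = QuotientGroup.mk' _ (matS⁻¹ * matT) := lift237_b ..

theorem proj_c : proj c = QuotientGroup.mk' _ matT := by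
  rw [c, map_mul, proj_a, proj_b, ← map_mul, mul_inv_cancel_left]

theorem proj_p : proj p = QuotientGroup.mk' _ (pWord matS matT) := by
  rw [p, map_pWord, map_pWord, proj_a, proj_c]

theorem proj_embedding (g : SymSurfaceGroup) : proj (embedding g) = 1 := by
  have : proj.comp embedding = 1 := by
    refine PresentedGroup.ext fun i => ?_
    change proj (embedding (t i)) = 1
    rw [embedding_t, map_tWord, proj_a, proj_c, ← map_tWord]
    refine mk_eq_one_iff.2 ?_
    revert i; decide +kernel
  exact DFunLike.congr_fun this g

/-! ### Coset enumeration: the surface group fills the kernel -/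

section Cosets

variable {H : Type*} [Group H]

/-- Coset representatives of the stabilizer of the point at infinity. -/
def rep (a c : H) (k : Fin 8) : H :=
  ![1, a, c * a, c ^ 2 * a, c ^ 3 * a, c ^ 4 * a, c ^ 5 * a, c ^ 6 * a] k

theorem map_rep {H' : Type*} [Group H'] (f : H →* H') (a c : H) (k : Fin 8) :
    f (rep a c k) = rep (f a) (f c) k := by
  fin_cases k <;> simp [rep]

/-- The elements of the subset `⟨p⟩⟨c⟩K`. -/
def InStabilizer (a c : H) (K : Subgroup H) (h : H) : Prop :=
  ∃ j i : ℕ, ∃ κ ∈ K, h = pWord a c ^ j * c ^ i * κ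

variable {a c : H} {K : Subgroup H}

theorem tWord_mul (hc : c ^ 7 = 1) (m : ZMod 7) :
    dWord a c * c ^ m.val = c ^ (m.val + 2) * tWord a c m := by
  have h14 : c ^ 14 = 1 := by rw [show 14 = 7 * 2 from rfl, pow_mul, hc, one_pow]
  have hm : m.val < 7 := ZMod.val_lt m
  rw [tWord, ← mul_assoc, ← mul_assoc, ← pow_add,
    show m.val + 2 + (12 - m.val) = 14 by omega, h14, one_mul]

theorem pow_val_natCast (hc : c ^ 7 = 1) (i : ℕ) : c ^ (i : ZMod 7).val = c ^ i := by
  rw [ZMod.val_natCast, ← pow_eq_pow_mod i hc]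

theorem InStabilizer.p_mul {h : H} (hh : InStabilizer a c K h) :
    InStabilizer a c K (pWord a c * h) := by
  obtain ⟨j, i, κ, hκ, rfl⟩ := hh
  exact ⟨j + 1, i, κ, hκ, by rw [pow_succ']; group⟩

theorem InStabilizer.c_mul (hc : c ^ 7 = 1) (hp : pWord a c ^ 3 = 1)
    (hpc : (pWord a c * c) ^ 3 = 1) (hK : ∀ i, tWord a c i ∈ K) {h : H}
    (hh : InStabilizer a c K h) : InStabilizer a c K (c * h) := by
  obtain ⟨j, i, κ, hκ, rfl⟩ := hh
  rw [pow_eq_pow_mod j hp]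
  have hj : j % 3 < 3 := Nat.mod_lt _ (by norm_num)
  interval_cases j % 3
  · exact ⟨0, i + 1, κ, hκ, by rw [pow_succ']; group⟩
  -- Here c p = p d, and `tWord_mul` moves d past the power of `c`.
  · refine ⟨1, (i : ZMod 7).val + 2, tWord a c i * κ, K.mul_mem (hK _) hκ, ?_⟩
    calc _ = pWord a c * ((pWord a c)⁻¹ * c * pWord a c) * c ^ i * κ := by group
      _ = pWord a c * (dWord a c * c ^ (i : ZMod 7).val) * κ := by
        rw [← dWord_eq hp, pow_val_natCast hc, ← mul_assoc]
      _ = _ := by rw [tWord_mul hc, pow_one]; simp only [mul_assoc]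
  -- Here c p² = p² (d c)⁻¹. The choice m = i - 2, written as i + 5 to avoid subtraction, makes
  -- `tWord_mul` at `m` end in the power `c ^ i`.
  · set m : ZMod 7 := ((i + 5 : ℕ) : ZMod 7) with hm
    refine ⟨2, m.val + 6, (tWord a c m)⁻¹ * κ, K.mul_mem (K.inv_mem (hK _)) hκ, ?_⟩
    have e : (dWord a c * c) * (c ^ (m.val + 6) * (tWord a c m)⁻¹) = c ^ i := by
      calc _ = dWord a c * (c ^ 7 * c ^ m.val) * (tWord a c m)⁻¹ := by
            rw [← pow_add, show 7 + m.val = 1 + (m.val + 6) by ring, pow_add c 1, pow_one]; group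
        _ = c ^ (m.val + 2) := by rw [hc, one_mul, tWord_mul hc, mul_inv_cancel_right]
        _ = c ^ (i + 7) := by
          rw [pow_add, hm, pow_val_natCast hc, ← pow_add]
        _ = c ^ i := by rw [pow_add, hc, mul_one]
    have e2 : c * pWord a c ^ 2 = pWord a c ^ 2 * (dWord a c * c)⁻¹ := by
      rw [dWord_mul_inv hpc]
      calc _ = 1 * c * (pWord a c)⁻¹ := by
            rw [eq_inv_of_mul_eq_one_left (a := pWord a c ^ 2) (b := pWord a c)
              (by rw [← pow_succ, hp]), one_mul]
        _ = _ := by rw [← hp]; group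
    calc _ = c * pWord a c ^ 2 * c ^ i * κ := by group
      _ = _ := by rw [e2, ← e]; group

theorem InStabilizer.c_pow_mul (hc : c ^ 7 = 1) (hp : pWord a c ^ 3 = 1)
    (hpc : (pWord a c * c) ^ 3 = 1) (hK : ∀ i, tWord a c i ∈ K) {h : H}
    (hh : InStabilizer a c K h) (n : ℕ) : InStabilizer a c K (c ^ n * h) := by
  induction n with
  | zero => simpa
  | succ n ih => rw [pow_succ', mul_assoc]; exact ih.c_mul hc hp hpc hK

/-- The elements of the subset `⋃ rep k ⟨p⟩⟨c⟩K`. -/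
def InCosets (a c : H) (K : Subgroup H) (g : H) : Prop :=
  ∃ k h, InStabilizer a c K h ∧ g = rep a c k * h

theorem InCosets.c_mul (hc : c ^ 7 = 1) (hp : pWord a c ^ 3 = 1)
    (hpc : (pWord a c * c) ^ 3 = 1) (hK : ∀ i, tWord a c i ∈ K) {g : H}
    (hg : InCosets a c K g) : InCosets a c K (c * g) := by
  obtain ⟨k, h, hh, rfl⟩ := hg
  fin_cases k
  · exact ⟨0, c * h, hh.c_mul hc hp hpc hK, by simp [rep]⟩
  · exact ⟨2, h, hh, by simp [rep, mul_assoc]⟩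
  · exact ⟨3, h, hh, by simp [rep, mul_assoc, pow_succ]⟩
  · exact ⟨4, h, hh, by simp [rep, mul_assoc, pow_succ]⟩
  · exact ⟨5, h, hh, by simp [rep, mul_assoc, pow_succ]⟩
  · exact ⟨6, h, hh, by simp [rep, mul_assoc, pow_succ]⟩
  · exact ⟨7, h, hh, by simp [rep, mul_assoc, pow_succ]⟩
  · refine ⟨1, h, hh, ?_⟩
    change c * (c ^ 6 * a * h) = a * h
    rw [← one_mul (a * h), ← hc]; group

/-- Left multiplication by `a` permutes the representatives as `lineInvolution` does, and the
remaining factors are the entries of `inducedInvolution`. -/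
theorem InCosets.a_mul (ha : a * a = 1) (hc : c ^ 7 = 1) (hac : (a * c) ^ 3 = 1)
    (hK : ∀ i, tWord a c i ∈ K) {g : H}
    (hg : InCosets a c K g) : InCosets a c K (a * g) := by
  have hp := pWord_pow_three ha hc hac
  have hpc := pWord_mul_pow_three ha hc hac
  have ha' : a⁻¹ = a := inv_eq_of_mul_eq_one_left ha
  have haa : ∀ x, a * (a * x) = x := fun x => by rw [← mul_assoc, ha, one_mul]
  have haca := mul_mul_eq_of_pow_three ha hac
  have hpinv : pWord a c ^ 2 = (pWord a c)⁻¹ := eq_inv_of_mul_eq_one_left (by rw [← pow_succ, hp])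
  have h6 : c ^ 6 = c⁻¹ := eq_inv_of_mul_eq_one_left (by rw [← pow_succ, hc])
  have hpc' := pWord_mul_eq ha hc hac
  obtain ⟨k, h, hh, rfl⟩ := hg
  fin_cases k
  · exact ⟨1, h, hh, by simp [rep]⟩
  · exact ⟨0, h, hh, by simp [rep, haa]⟩
  · refine ⟨7, c ^ 6 * h, hh.c_pow_mul hc hp hpc hK 6, ?_⟩
    change a * (c * a * h) = c ^ 6 * a * (c ^ 6 * h)
    rw [h6, ← mul_assoc, ← mul_assoc, haca]; group
  · refine ⟨4, pWord a c * h, hh.p_mul, ?_⟩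
    change a * (c ^ 2 * a * h) = c ^ 3 * a * (pWord a c * h)
    calc _ = 1 * a * c ^ 2 * a * h := by group
      _ = c ^ 3 * 1 * c ^ 4 * a * c ^ 2 * a * h := by rw [mul_one, ← pow_add, hc]
      _ = _ := by rw [← ha, pWord]; group
  · refine ⟨3, pWord a c * (pWord a c * h), hh.p_mul.p_mul, ?_⟩
    change a * (c ^ 3 * a * h) = c ^ 2 * a * (pWord a c * (pWord a c * h))
    rw [← mul_assoc (pWord a c), ← sq, hpinv, pWord]
    simp only [mul_inv_rev, ha', mul_assoc, haa]
    calc _ = a * (c ^ 7 * (c ^ 4)⁻¹) * a * h := by group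
      _ = _ := by rw [hc, one_mul]; simp only [mul_assoc, mul_inv_cancel_left]
  · refine ⟨6, c ^ 6 * (pWord a c * (pWord a c * h)), hh.p_mul.p_mul.c_pow_mul hc hp hpc hK 6, ?_⟩
    change a * (c ^ 4 * a * h) = c ^ 5 * a * _
    rw [← mul_assoc (pWord a c), ← sq, hpinv, h6, ← mul_assoc c⁻¹, ← mul_inv_rev, hpc']
    simp only [mul_inv_rev, inv_inv, ha', mul_assoc, haa]
    group
  · refine ⟨5, pWord a c * (c * h), (hh.c_mul hc hp hpc hK).p_mul, ?_⟩
    change a * (c ^ 5 * a * h) = c ^ 4 * a * _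
    rw [← mul_assoc (pWord a c), hpc']
    group
  · refine ⟨2, c * h, hh.c_mul hc hp hpc hK, ?_⟩
    change a * (c ^ 6 * a * h) = c * a * (c * h)
    have : a * c⁻¹ * a = c * a * c := by
      simpa [ha', mul_assoc] using congrArg (·⁻¹) haca
    rw [h6, ← mul_assoc, ← mul_assoc, this]; group

end Cosets

/-- The union of the 168 cosets contains 1 and is stable under left multiplication by the generators
and their inverses. -/
theorem inCosets (g : TriangleGroup 2 3 7) : InCosets a c embedding.range g := by
  have hK : ∀ i, tWord a c i ∈ embedding.range := fun i => ⟨t i, embedding_t i⟩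
  have hA : ∀ {g}, InCosets a c embedding.range g → InCosets a c embedding.range (a * g) :=
    InCosets.a_mul a_mul_a c_pow_seven a_mul_c_pow_three hK
  have hC : ∀ {g}, InCosets a c embedding.range g → InCosets a c embedding.range (c * g) :=
    InCosets.c_mul c_pow_seven p_pow_three p_mul_c_pow_three hK
  have hB : ∀ {g}, InCosets a c embedding.range g → InCosets a c embedding.range (b * g) :=
    fun hg => by rw [b_eq, mul_assoc]; exact hA (hC hg)
  suffices ∀ w g, InCosets a c embedding.range g →
      InCosets a c embedding.range (PresentedGroup.mk _ w * g) by
    obtain ⟨w, rfl⟩ := PresentedGroup.mk_surjective _ g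
    rw [← mul_one (PresentedGroup.mk _ w)]
    exact this w 1 ⟨0, 1, ⟨0, 0, 1, Subgroup.one_mem _, by simp⟩, by simp [rep]⟩
  intro w
  induction w using FreeGroup.induction_on with
  | C1 => intro g hg; rwa [map_one, one_mul]
  | of i =>
    intro g hg
    fin_cases i
    · exact hA hg
    · exact hB hg
  | inv_of i _ =>
    intro g hg
    rw [map_inv]
    fin_cases i
    · change InCosets a c embedding.range (a⁻¹ * g)
      rw [a_inv]; exact hA hg
    · change InCosets a c embedding.range (b⁻¹ * g)
      have : b⁻¹ = b * b := inv_eq_of_mul_eq_one_left (by rw [← b_cube, pow_succ b 2, sq b])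
      rw [this, mul_assoc]; exact hB (hB hg)
  | mul x y hx hy =>
    intro g hg
    rw [map_mul, mul_assoc]
    exact hx _ (hy _ hg)

theorem rep_eq_one_of_mem_center : ∀ (k : Fin 8) (j : Fin 3) (i : Fin 7),
    (rep matS matT k * pWord matS matT ^ j.val * matT ^ i.val) 0 1 = 0 →
    (rep matS matT k * pWord matS matT ^ j.val * matT ^ i.val) 1 0 = 0 →
    (rep matS matT k * pWord matS matT ^ j.val * matT ^ i.val) 0 0 =
      (rep matS matT k * pWord matS matT ^ j.val * matT ^ i.val) 1 1 →
    k = 0 ∧ j = 0 ∧ i = 0 := by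
  decide +kernel

theorem ker_proj : proj.ker = embedding.range := by
  refine le_antisymm (fun g hg => ?_) ?_
  · obtain ⟨k, h, ⟨j, i, κ, hκ, rfl⟩, rfl⟩ := inCosets g
    obtain ⟨x, rfl⟩ := hκ
    change _ * (p ^ j * c ^ i * _) ∈ _
    change proj (_ * (p ^ j * c ^ i * _)) = 1 at hg
    rw [pow_eq_pow_mod j p_pow_three, pow_eq_pow_mod i c_pow_seven] at hg ⊢
    rw [map_mul, map_mul, proj_embedding, mul_one, map_mul, map_pow, map_pow, map_rep, proj_p,
      proj_a, proj_c, ← map_rep, ← map_pow, ← map_pow, ← map_mul, ← map_mul, ← mul_assoc] at hg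
    obtain ⟨h1, h2, h3⟩ := mk_eq_one_iff.1 hg
    obtain ⟨rfl, hj, hi⟩ := rep_eq_one_of_mem_center k ⟨j % 3, Nat.mod_lt _ (by norm_num)⟩
      ⟨i % 7, Nat.mod_lt _ (by norm_num)⟩ h1 h2 h3
    rw [Fin.ext_iff] at hj hi
    dsimp at hj hi
    rw [hj, hi]
    exact ⟨x, by simp [rep]⟩
  · rintro _ ⟨x, rfl⟩
    exact proj_embedding x

/-! ### Surjectivity onto PSL(2,7) -/

theorem matT_pow (n : ℕ) : (↑(matT ^ n) : Matrix (Fin 2) (Fin 2) (ZMod 7)) =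
    !![1, (n : ZMod 7); 0, 1] := by
  induction n with
  | zero => ext i j; fin_cases i <;> fin_cases j <;> rfl
  | succ n ih =>
    rw [pow_succ, Matrix.SpecialLinearGroup.coe_mul, ih, matT]
    simp [add_comm]

instance : Fact (Nat.Prime 7) := ⟨by norm_num⟩

/-- The big Bruhat cell: S Tⁿ S has rows (-1, 0) and (n, -1). Taking n = `A 1 0`, powers of T on
either side correct the diagonal, and the determinant settles the last entry. -/
theorem eq_word_of_ne_zero (A : SL(2, ZMod 7)) (h : A 1 0 ≠ 0) :
    A = matT ^ ((A 0 0 + 1) * (A 1 0)⁻¹).val * matS * matT ^ (A 1 0).val * matS *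
      matT ^ ((A 1 1 + 1) * (A 1 0)⁻¹).val := by
  have hdet := A.det_coe
  rw [Matrix.det_fin_two] at hdet
  apply Subtype.ext
  simp only [Matrix.SpecialLinearGroup.coe_mul, matT_pow, ZMod.natCast_zmod_val, coe_matS]
  ext i j
  fin_cases i <;> fin_cases j <;> simp <;> field_simp
  · ring
  · linear_combination (-1 : ZMod 7) * hdet
  · ring

theorem mem_of_matS_mem_of_matT_mem {R : Subgroup SL(2, ZMod 7)} (hS : matS ∈ R)
    (hT : matT ∈ R) (A : SL(2, ZMod 7)) : A ∈ R := by
  have key : ∀ B : SL(2, ZMod 7), B 1 0 ≠ 0 → B ∈ R := fun B hB => by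
    rw [eq_word_of_ne_zero B hB]
    exact R.mul_mem (R.mul_mem (R.mul_mem (R.mul_mem (R.pow_mem hT _) hS) (R.pow_mem hT _)) hS)
      (R.pow_mem hT _)
  by_cases h : A 1 0 = 0
  -- Left multiplication by `matS` moves `A 0 0`, nonzero by the determinant, to the lower left
  -- corner.
  · refine (R.mul_mem_cancel_left hS).1 (key _ ?_)
    have hdet := A.det_coe
    rw [Matrix.det_fin_two, h] at hdet
    have : (matS * A) 1 0 = A 0 0 := by
      rw [Matrix.SpecialLinearGroup.coe_mul, coe_matS, Matrix.mul_apply]; simp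
    rw [this]
    rintro h0
    simp [h0] at hdet
  · exact key A h

theorem proj_surjective : Function.Surjective proj := by
  intro x
  obtain ⟨A, rfl⟩ := QuotientGroup.mk'_surjective _ x
  exact mem_of_matS_mem_of_matT_mem (R := proj.range.comap (QuotientGroup.mk' _))
    ⟨a, proj_a⟩ ⟨c, proj_c⟩ A

/-- The kernel of the projection to `PSL(2, 7)` is `SymSurfaceGroup`. -/
noncomputable def kerProjEquiv : proj.ker ≃* SymSurfaceGroup :=
  ((MonoidHom.ofInjective embedding_injective).trans
    (MulEquiv.subgroupCongr ker_proj.symm)).symm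

end KleinQuartic

namespace KleinQuartic

/-! ### The standard presentation of the genus three surface group -/

/-- The generator `a_i` of the genus three surface group. -/
def sa (i : Fin 3) : SurfaceGroup 3 := PresentedGroup.of (Sum.inl i)

/-- The generator `b_i` of the genus three surface group. -/
def sb (i : Fin 3) : SurfaceGroup 3 := PresentedGroup.of (Sum.inr i)

/-- The product of three commutators. -/
def commProd {H : Type*} [Group H] (x y : Fin 3 → H) : H :=
  x 0 * y 0 * (x 0)⁻¹ * (y 0)⁻¹ * (x 1 * y 1 * (x 1)⁻¹ * (y 1)⁻¹) *
    (x 2 * y 2 * (x 2)⁻¹ * (y 2)⁻¹)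

theorem lift_surface_relator {H : Type*} [Group H] (x y : Fin 3 → H) :
    FreeGroup.lift (Sum.elim x y) (List.ofFn fun i : Fin 3 =>
      FreeGroup.of (Sum.inl i) * FreeGroup.of (Sum.inr i) *
        (FreeGroup.of (Sum.inl i))⁻¹ * (FreeGroup.of (Sum.inr i))⁻¹).prod = commProd x y := by
  simp [commProd, List.ofFn_succ, mul_assoc]

/-- The homomorphism out of the genus three surface group determined by six elements with trivial
product of commutators. -/
def surfaceLift {H : Type*} [Group H] (x y : Fin 3 → H) (h : commProd x y = 1) :
    SurfaceGroup 3 →* H :=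
  PresentedGroup.toGroup (f := Sum.elim x y) (by
    rintro r rfl
    rw [lift_surface_relator, h])

@[simp] theorem surfaceLift_sa {H : Type*} [Group H] {x y : Fin 3 → H} (h : commProd x y = 1)
    (i : Fin 3) : surfaceLift x y h (sa i) = x i :=
  PresentedGroup.toGroup.of _

@[simp] theorem surfaceLift_sb {H : Type*} [Group H] {x y : Fin 3 → H} (h : commProd x y = 1)
    (i : Fin 3) : surfaceLift x y h (sb i) = y i :=
  PresentedGroup.toGroup.of _

theorem surface_hom_ext {H : Type*} [Group H] {f g : SurfaceGroup 3 →* H}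
    (ha : ∀ i, f (sa i) = g (sa i)) (hb : ∀ i, f (sb i) = g (sb i)) : f = g :=
  PresentedGroup.ext fun i => i.rec ha hb

theorem commProd_surface : commProd sa sb = 1 := by
  rw [← lift_surface_relator]
  have : FreeGroup.lift (Sum.elim sa sb) = PresentedGroup.mk _ :=
    FreeGroup.ext_hom _ _ fun i => by
      rw [FreeGroup.lift_apply_of]
      cases i <;> rfl
  rw [this]
  exact PresentedGroup.one_of_mem (Set.mem_singleton _)

section Words

variable {H : Type*} [Group H]

/-- The standard generators `a_i` in terms of the generators `t_i`. -/
def aWord (s : ZMod 7 → H) : Fin 3 → H :=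
  ![s 4 * s 6 * (s 4)⁻¹ * (s 6)⁻¹ * (s 1)⁻¹ * (s 3)⁻¹ * (s 6)⁻¹ * (s 4)⁻¹, s 4 * s 0, s 6]

/-- The standard generators `b_i` in terms of the generators `t_i`. -/
def bWord (s : ZMod 7 → H) : Fin 3 → H :=
  ![s 4 * (s 2)⁻¹ * (s 6)⁻¹ * (s 4)⁻¹, (s 1)⁻¹ * (s 4)⁻¹, s 4]

/-- Eliminating `s 5` leaves one relator in which each of six letters occurs once with each sign.
Cutting and pasting brings it to a product of three commutators, up to the conjugation given
explicitly in the proof. -/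
theorem commProd_words {s : ZMod 7 → H} (h₂ : s 5 * s 3 * s 1 * s 6 * s 4 * s 2 * s 0 = 1)
    (h₃ : s 5 * s 2 * s 6 * s 3 * s 0 * s 4 * s 1 = 1) :
    commProd (aWord s) (bWord s) = 1 := by
  have e₂ : (s 5)⁻¹ = s 3 * s 1 * s 6 * s 4 * s 2 * s 0 :=
    inv_eq_of_mul_eq_one_right (by simpa only [mul_assoc] using h₂)
  have e₃ : (s 5)⁻¹ = s 2 * s 6 * s 3 * s 0 * s 4 * s 1 :=
    inv_eq_of_mul_eq_one_right (by simpa only [mul_assoc] using h₃)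
  have key : s 3 * s 1 * s 6 * s 4 * s 2 * s 0 * (s 2 * s 6 * s 3 * s 0 * s 4 * s 1)⁻¹ = 1 := by
    rw [← e₂, ← e₃, mul_inv_cancel]
  rw [← conj_eq_one_iff (a := s 3 * s 1 * s 6 * s 4 * s 2 * s 0 * (s 1)⁻¹ * (s 4)⁻¹ * (s 0)⁻¹ *
    s 1 * s 6 * s 4 * (s 6)⁻¹ * (s 4)⁻¹), ← key]
  simp only [commProd, aWord, bWord, Matrix.cons_val_zero, Matrix.cons_val_one, Matrix.cons_val]
  group

/-- The generators `t_i` in terms of the standard generators. -/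
def sWord (x y : Fin 3 → H) : ZMod 7 → H :=
  ![(y 2)⁻¹ * x 1, (y 2)⁻¹ * (y 1)⁻¹, (x 2)⁻¹ * (y 2)⁻¹ * (y 0)⁻¹ * y 2,
    (x 2)⁻¹ * (y 2)⁻¹ * (x 0)⁻¹ * y 2 * x 2 * (y 2)⁻¹ * (x 2)⁻¹ * y 1 * y 2, y 2,
    (((x 2)⁻¹ * (y 2)⁻¹ * (x 0)⁻¹ * y 2 * x 2 * (y 2)⁻¹ * (x 2)⁻¹ * y 1 * y 2) *
      ((y 2)⁻¹ * (y 1)⁻¹) * x 2 * y 2 * ((x 2)⁻¹ * (y 2)⁻¹ * (y 0)⁻¹ * y 2) *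
      ((y 2)⁻¹ * x 1))⁻¹, x 2]

section

variable (x y : Fin 3 → H)

theorem sWord_zero : sWord x y 0 = (y 2)⁻¹ * x 1 := rfl

theorem sWord_one : sWord x y 1 = (y 2)⁻¹ * (y 1)⁻¹ := rfl

theorem sWord_two : sWord x y 2 = (x 2)⁻¹ * (y 2)⁻¹ * (y 0)⁻¹ * y 2 := rfl

theorem sWord_three : sWord x y 3 =
    (x 2)⁻¹ * (y 2)⁻¹ * (x 0)⁻¹ * y 2 * x 2 * (y 2)⁻¹ * (x 2)⁻¹ * y 1 * y 2 := rfl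

theorem sWord_four : sWord x y 4 = y 2 := rfl

theorem sWord_five : sWord x y 5 = (sWord x y 3 * sWord x y 1 * sWord x y 6 * sWord x y 4 *
    sWord x y 2 * sWord x y 0)⁻¹ := rfl

theorem sWord_six : sWord x y 6 = x 2 := rfl

end

theorem sWord_rel_two (x y : Fin 3 → H) :
    sWord x y 5 * sWord x y 3 * sWord x y 1 * sWord x y 6 * sWord x y 4 * sWord x y 2 *
      sWord x y 0 = 1 := by
  rw [sWord_five]
  group

/-- `sWord x y 5` is defined by solving the first relator, so all content is in the second, which
becomes a conjugate of the inverse of `commProd x y`. -/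
theorem sWord_rel_three {x y : Fin 3 → H} (h : commProd x y = 1) :
    sWord x y 5 * sWord x y 2 * sWord x y 6 * sWord x y 3 * sWord x y 0 * sWord x y 4 *
      sWord x y 1 = 1 := by
  have key : commProd x y = ((sWord x y 1)⁻¹ * (sWord x y 4)⁻¹ * (sWord x y 0)⁻¹ * sWord x y 1 *
      sWord x y 6 * sWord x y 4 * (sWord x y 6)⁻¹ * (sWord x y 4)⁻¹)⁻¹ *
      (sWord x y 5 * sWord x y 2 * sWord x y 6 * sWord x y 3 * sWord x y 0 * sWord x y 4 *
        sWord x y 1)⁻¹ *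
      ((sWord x y 1)⁻¹ * (sWord x y 4)⁻¹ * (sWord x y 0)⁻¹ * sWord x y 1 *
      sWord x y 6 * sWord x y 4 * (sWord x y 6)⁻¹ * (sWord x y 4)⁻¹) := by
    simp only [sWord_zero, sWord_one, sWord_two, sWord_three, sWord_four, sWord_five, sWord_six,
      commProd]
    group
  rw [h, eq_comm, mul_eq_one_iff_eq_inv, mul_eq_left, inv_eq_one] at key
  exact key

theorem aWord_sWord (x y : Fin 3 → H) (i : Fin 3) : aWord (sWord x y) i = x i := by
  fin_cases i <;>
    simp only [aWord, sWord_zero, sWord_one, sWord_three, sWord_four, sWord_six,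
      Fin.zero_eta, Fin.mk_one, Fin.reduceFinMk, Matrix.cons_val] <;> group

theorem bWord_sWord (x y : Fin 3 → H) (i : Fin 3) : bWord (sWord x y) i = y i := by
  fin_cases i <;>
    simp only [bWord, sWord_one, sWord_two, sWord_four, sWord_six,
      Fin.zero_eta, Fin.mk_one, Fin.reduceFinMk, Matrix.cons_val] <;> group

theorem sWord_words {s : ZMod 7 → H} (h₂ : s 5 * s 3 * s 1 * s 6 * s 4 * s 2 * s 0 = 1)
    (i : ZMod 7) : sWord (aWord s) (bWord s) i = s i := by
  have h0 : sWord (aWord s) (bWord s) 0 = s 0 := by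
    simp only [sWord_zero, aWord, bWord, Matrix.cons_val]; group
  have h1 : sWord (aWord s) (bWord s) 1 = s 1 := by
    simp only [sWord_one, bWord, Matrix.cons_val]; group
  have h2 : sWord (aWord s) (bWord s) 2 = s 2 := by
    simp only [sWord_two, aWord, bWord, Matrix.cons_val]; group
  have h3 : sWord (aWord s) (bWord s) 3 = s 3 := by
    simp only [sWord_three, aWord, bWord, Matrix.cons_val]; group
  have h4 : sWord (aWord s) (bWord s) 4 = s 4 := rfl
  have h6 : sWord (aWord s) (bWord s) 6 = s 6 := rfl
  have h5 : sWord (aWord s) (bWord s) 5 = s 5 := by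
    rw [sWord_five, h0, h1, h2, h3, h4, h6, eq_comm]
    exact eq_inv_of_mul_eq_one_left (by simpa only [mul_assoc] using h₂)
  fin_cases i
  exacts [h0, h1, h2, h3, h4, h5, h6]

theorem map_aWord {H' : Type*} [Group H'] (f : H →* H') (s : ZMod 7 → H) (i : Fin 3) :
    f (aWord s i) = aWord (f ∘ s) i := by
  fin_cases i <;> simp [aWord]

theorem map_bWord {H' : Type*} [Group H'] (f : H →* H') (s : ZMod 7 → H) (i : Fin 3) :
    f (bWord s i) = bWord (f ∘ s) i := by
  fin_cases i <;> simp [bWord]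

theorem map_sWord {H' : Type*} [Group H'] (f : H →* H') (x y : Fin 3 → H) (i : ZMod 7) :
    f (sWord x y i) = sWord (f ∘ x) (f ∘ y) i := by
  fin_cases i <;> simp [sWord, mul_assoc]

end Words

/-- The standard generators in terms of the cyclically symmetric ones. -/
def surfaceToCyclic : SurfaceGroup 3 →* SymSurfaceGroup :=
  surfaceLift (aWord t) (bWord t) (commProd_words t_rel_two t_rel_three)

/-- The cyclically symmetric generators in terms of the standard ones. -/
def cyclicToSurface : SymSurfaceGroup →* SurfaceGroup 3 :=
  SymSurfaceGroup.lift (sWord sa sb) (sWord_rel_two _ _) (sWord_rel_three commProd_surface)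

theorem surfaceToCyclic_sa : surfaceToCyclic ∘ sa = aWord t := funext fun _ => surfaceLift_sa ..

theorem surfaceToCyclic_sb : surfaceToCyclic ∘ sb = bWord t := funext fun _ => surfaceLift_sb ..

theorem cyclicToSurface_t : cyclicToSurface ∘ t = sWord sa sb :=
  funext fun _ => SymSurfaceGroup.lift_t ..

theorem surfaceToCyclic_cyclicToSurface (i : ZMod 7) :
    surfaceToCyclic (cyclicToSurface (t i)) = t i := by
  rw [← Function.comp_apply (f := cyclicToSurface), cyclicToSurface_t, map_sWord,
    surfaceToCyclic_sa, surfaceToCyclic_sb, sWord_words t_rel_two]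

/-- The two presentations of the genus three surface group agree. -/
def cyclicEquivSurface : SymSurfaceGroup ≃* SurfaceGroup 3 :=
  MonoidHom.toMulEquiv cyclicToSurface surfaceToCyclic
    (PresentedGroup.ext surfaceToCyclic_cyclicToSurface)
    (by
      refine surface_hom_ext (fun i => ?_) fun i => ?_
      · rw [MonoidHom.comp_apply, ← Function.comp_apply (f := surfaceToCyclic),
          surfaceToCyclic_sa, map_aWord, cyclicToSurface_t, aWord_sWord]; rfl
      · rw [MonoidHom.comp_apply, ← Function.comp_apply (f := surfaceToCyclic),
          surfaceToCyclic_sb, map_bWord, cyclicToSurface_t, bWord_sWord]; rfl)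

end KleinQuartic

/-! ### Centres of HNN extensions -/

namespace HNNExtension

variable {G : Type*} [Group G] {A B : Subgroup G} {φ : A ≃* B}

/-- If z has a reduced word with stable letters, then for `k` in the base both `k * z` and `z * k`
have evident reduced words, differing from it only at the head or at the tail. Uniqueness of the
head modulo an associated subgroup forces that subgroup to be everything. -/
theorem mem_range_of_of_mem_center (hA : A ≠ ⊤) (hB : B ≠ ⊤) {z : HNNExtension G A B φ}
    (hz : z ∈ Subgroup.center (HNNExtension G A B φ)) : ∃ g, z = of g := by
  obtain ⟨d⟩ := NormalWord.TransversalPair.nonempty G A B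
  obtain ⟨w, rfl⟩ : ∃ w : NormalWord.ReducedWord G A B, w.prod φ = z :=
    ⟨(z • (NormalWord.empty : NormalWord d)).toReducedWord, by
      rw [NormalWord.prod_smul, NormalWord.prod_empty, mul_one]⟩
  rcases List.eq_nil_or_concat w.toList with h | ⟨l, ⟨u, g⟩, h⟩
  · exact ⟨w.head, by simp [NormalWord.ReducedWord.prod, h]⟩
  exfalso
  have hchain := w.chain
  rw [h] at hchain
  have hne : w.toList.head?.map Prod.fst ≠ none := by simp [h]
  obtain ⟨e, he⟩ := Option.ne_none_iff_exists'.1 hne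
  have key : ∀ x, x ∈ toSubgroup A B (-e) := by
    intro x
    -- With this choice the heads of `w₁` and `w₂` differ by exactly `x`.
    let k : G := w.head * x⁻¹ * w.head⁻¹
    let w₁ : NormalWord.ReducedWord G A B := ⟨k * w.head, w.toList, w.chain⟩
    let w₂ : NormalWord.ReducedWord G A B := ⟨w.head, l ++ [(u, g * k)], by
      rw [List.concat_eq_append] at hchain
      rw [List.isChain_append] at hchain ⊢
      refine ⟨hchain.1, List.isChain_singleton _, ?_⟩
      simpa using hchain.2.2⟩
    have h₁ : w₁.prod φ = of k * w.prod φ := by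
      simp [w₁, NormalWord.ReducedWord.prod, mul_assoc]
    have h₂ : w₂.prod φ = w.prod φ * of k := by
      simp [w₂, NormalWord.ReducedWord.prod, h, mul_assoc]
    have := (ReducedWord.map_fst_eq_and_of_prod_eq φ (w₁ := w₁) (w₂ := w₂) (by
      rw [h₁, h₂, Subgroup.mem_center_iff.1 hz])).2 e he
    simpa [w₁, w₂, k, mul_assoc] using this
  rcases Int.units_eq_one_or e with rfl | rfl
  · exact hB ((Subgroup.eq_top_iff' _).2 key)
  · exact hA ((Subgroup.eq_top_iff' _).2 key)

/-- For `g` outside `A` the word t g t⁻¹ is reduced, so by Britton's lemma it cannot equal `g`. -/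
theorem mem_of_of_mem_center {g : G}
    (hg : (of g : HNNExtension G A B φ) ∈ Subgroup.center (HNNExtension G A B φ)) : g ∈ A := by
  by_contra h
  let w : NormalWord.ReducedWord G A B := ⟨1, [(1, g), (-1, 1)], by simpa using h⟩
  have hw : w.prod φ = of g := by
    have := Subgroup.mem_center_iff.1 hg t
    simp [w, NormalWord.ReducedWord.prod, this]
  have := ReducedWord.toList_eq_nil_of_mem_of_range φ w ⟨g, hw.symm⟩
  simp [w] at this

end HNNExtension

namespace KleinQuartic

/-! ### The centre of the surface group -/

/-- The free group on `b₁, a₂, b₂, a₃, b₃`. -/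
abbrev Base : Type := FreeGroup (Fin 5)

/-- A representation of the free group in which no power of the generator `0` commutes with the
generator `1`. -/
def baseRep : Base →* Equiv.Perm ℤ :=
  FreeGroup.lift ![Equiv.addRight 1, Equiv.swap 0 1, 1, 1, 1]

theorem eq_zero_of_commute (n : ℤ)
    (h : (FreeGroup.of 0 : Base) ^ n * FreeGroup.of 1 = FreeGroup.of 1 * FreeGroup.of 0 ^ n) :
    n = 0 := by
  -- Evaluation at 0 compares n + 1 with the image of n under the transposition of 0 and 1.
  have h := Equiv.Perm.congr_fun (congrArg baseRep h) 0
  simp [baseRep] at h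
  by_contra hn
  by_cases h1 : n = 1
  · subst h1; simp at h
  · rw [Equiv.swap_apply_of_ne_of_ne hn h1] at h
    omega

theorem range_zpowersHom_ne_top (y : Base) : (zpowersHom Base y).range ≠ ⊤ := by
  intro h
  obtain ⟨m, hm⟩ : FreeGroup.of 0 ∈ (zpowersHom Base y).range := h ▸ Subgroup.mem_top _
  obtain ⟨n, hn⟩ : FreeGroup.of 1 ∈ (zpowersHom Base y).range := h ▸ Subgroup.mem_top _
  refine one_ne_zero (eq_zero_of_commute 1 ?_)
  rw [zpow_one, ← hm, ← hn, ← map_mul, ← map_mul, mul_comm]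

/-- The exponent sum of the generator `b₁`. -/
def exponentSum : Base →* Multiplicative ℤ :=
  FreeGroup.lift ![Multiplicative.ofAdd 1, 1, 1, 1, 1]

theorem zpowersHom_injective {y : Base} (hy : exponentSum y = Multiplicative.ofAdd 1) :
    Function.Injective (zpowersHom Base y) := by
  refine Function.LeftInverse.injective (g := exponentSum) fun n => ?_
  rw [zpowersHom_apply, map_zpow, hy, ← ofAdd_zsmul]
  simp

/-- The product of the second and third commutators. -/
def tailWord : Base :=
  FreeGroup.of 1 * FreeGroup.of 2 * (FreeGroup.of 1)⁻¹ * (FreeGroup.of 2)⁻¹ *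
    (FreeGroup.of 3 * FreeGroup.of 4 * (FreeGroup.of 3)⁻¹ * (FreeGroup.of 4)⁻¹)

theorem map_tailWord {H : Type*} [Group H] (f : Base →* H) :
    f tailWord = f (FreeGroup.of 1) * f (FreeGroup.of 2) * (f (FreeGroup.of 1))⁻¹ *
      (f (FreeGroup.of 2))⁻¹ * (f (FreeGroup.of 3) * f (FreeGroup.of 4) *
        (f (FreeGroup.of 3))⁻¹ * (f (FreeGroup.of 4))⁻¹) := by
  simp [tailWord]

theorem injective_source : Function.Injective (zpowersHom Base (FreeGroup.of 0)) :=
  zpowersHom_injective (by simp [exponentSum])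

theorem injective_target :
    Function.Injective (zpowersHom Base (tailWord⁻¹ * FreeGroup.of 0)) :=
  zpowersHom_injective (by simp [exponentSum, tailWord])

/-- The isomorphism of cyclic subgroups that conjugation by `a₁` realizes. -/
noncomputable def associatedEquiv :
    (zpowersHom Base (FreeGroup.of 0)).range ≃*
      (zpowersHom Base (tailWord⁻¹ * FreeGroup.of 0)).range :=
  (MonoidHom.ofInjective injective_source).symm.trans (MonoidHom.ofInjective injective_target)

theorem associatedEquiv_apply (n : Multiplicative ℤ) :
    (associatedEquiv ⟨zpowersHom Base (FreeGroup.of 0) n, n, rfl⟩ : Base) =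
      zpowersHom Base (tailWord⁻¹ * FreeGroup.of 0) n := by
  have : (⟨zpowersHom Base (FreeGroup.of 0) n, n, rfl⟩ :
      (zpowersHom Base (FreeGroup.of 0)).range) = MonoidHom.ofInjective injective_source n := rfl
  rw [this, associatedEquiv, MulEquiv.trans_apply, MulEquiv.symm_apply_apply]
  rfl

/-- The genus three surface group as an HNN extension of a free group. -/
abbrev SurfaceHNN : Type := HNNExtension Base _ _ associatedEquiv

/-- This is the surface relation solved for a₁ b₁, with a₁ as stable letter. -/
theorem hnn_relation :
    (HNNExtension.t * HNNExtension.of (FreeGroup.of 0) : SurfaceHNN) =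
      HNNExtension.of (tailWord⁻¹ * FreeGroup.of 0) * HNNExtension.t := by
  have h := HNNExtension.t_mul_of (φ := associatedEquiv)
    ⟨zpowersHom Base (FreeGroup.of 0) (Multiplicative.ofAdd 1), _, rfl⟩
  rw [associatedEquiv_apply] at h
  simpa using h

/-- The comparison map from the surface group to the HNN extension. -/
noncomputable def surfaceToHNN : SurfaceGroup 3 →* SurfaceHNN :=
  surfaceLift
    ![HNNExtension.t, HNNExtension.of (FreeGroup.of 1), HNNExtension.of (FreeGroup.of 3)]
    ![HNNExtension.of (FreeGroup.of 0), HNNExtension.of (FreeGroup.of 2),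
      HNNExtension.of (FreeGroup.of 4)] (by
    simp only [commProd, Matrix.cons_val]
    rw [hnn_relation, mul_inv_cancel_right, ← map_inv, ← map_mul, mul_inv_cancel_right,
      mul_assoc, map_inv, inv_mul_eq_one, map_tailWord])

/-- The images of the free generators in the surface group. -/
def baseToSurface : Base →* SurfaceGroup 3 :=
  FreeGroup.lift ![sb 0, sa 1, sb 1, sa 2, sb 2]

theorem semiconj_surface : SemiconjBy (sa 0) (baseToSurface (FreeGroup.of 0))
    (baseToSurface (tailWord⁻¹ * FreeGroup.of 0)) := by
  have h := commProd_surface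
  have hw : baseToSurface tailWord =
      (sa 1 * sb 1 * (sa 1)⁻¹ * (sb 1)⁻¹) * (sa 2 * sb 2 * (sa 2)⁻¹ * (sb 2)⁻¹) := by
    simp [map_tailWord, baseToSurface]
  have h0 : baseToSurface (FreeGroup.of 0) = sb 0 := by simp [baseToSurface]
  rw [commProd, mul_assoc _ (sa 1 * sb 1 * (sa 1)⁻¹ * (sb 1)⁻¹), ← hw] at h
  rw [SemiconjBy, map_mul, map_inv, h0, eq_comm, ← eq_inv_of_mul_eq_one_left h]
  group

/-- The comparison map from the HNN extension to the surface group. -/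
noncomputable def hnnToSurface : SurfaceHNN →* SurfaceGroup 3 :=
  HNNExtension.lift baseToSurface (sa 0) (by
    rintro ⟨_, n, rfl⟩
    rw [associatedEquiv_apply]
    simp only [zpowersHom_apply, map_zpow]
    exact semiconj_surface.zpow_right _)

theorem hnnToSurface_surfaceToHNN : hnnToSurface.comp surfaceToHNN = MonoidHom.id _ := by
  refine surface_hom_ext (fun i => ?_) fun i => ?_
  · rw [MonoidHom.comp_apply, surfaceToHNN, surfaceLift_sa]
    fin_cases i <;> simp [hnnToSurface, baseToSurface]
  · rw [MonoidHom.comp_apply, surfaceToHNN, surfaceLift_sb]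
    fin_cases i <;> simp [hnnToSurface, baseToSurface]

theorem surfaceToHNN_hnnToSurface : surfaceToHNN.comp hnnToSurface = MonoidHom.id _ := by
  refine HNNExtension.hom_ext (FreeGroup.ext_hom _ _ fun i => ?_) ?_
  · fin_cases i <;> simp [hnnToSurface, baseToSurface, surfaceToHNN]
  · simp [hnnToSurface, surfaceToHNN]

/-- In the HNN extension a central element lies in the base, then in the source subgroup, so it is a
power of b₁; commuting with a₂ makes it trivial. -/
theorem center_surface : Subgroup.center (SurfaceGroup 3) = ⊥ := by
  refine (Subgroup.eq_bot_iff_forall _).2 fun z hz => ?_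
  have hzz : surfaceToHNN z ∈ Subgroup.center SurfaceHNN := by
    refine Subgroup.mem_center_iff.2 fun g => ?_
    obtain ⟨g, rfl⟩ : ∃ x, surfaceToHNN x = g :=
      ⟨hnnToSurface g, DFunLike.congr_fun surfaceToHNN_hnnToSurface g⟩
    rw [← map_mul, ← map_mul, Subgroup.mem_center_iff.1 hz]
  obtain ⟨g, hg⟩ := HNNExtension.mem_range_of_of_mem_center (range_zpowersHom_ne_top _)
    (range_zpowersHom_ne_top _) hzz
  rw [hg] at hzz
  obtain ⟨n, rfl⟩ := HNNExtension.mem_of_of_mem_center hzz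
  have hn : n.toAdd = 0 := by
    refine eq_zero_of_commute _ (HNNExtension.of_injective (φ := associatedEquiv) ?_)
    have := Subgroup.mem_center_iff.1 hzz (HNNExtension.of (FreeGroup.of 1))
    exact (map_mul HNNExtension.of _ _).trans
      (this.symm.trans (map_mul HNNExtension.of _ _).symm)
  have hz1 : surfaceToHNN z = 1 := by
    rw [hg, zpowersHom_apply, hn, zpow_zero, map_one]
  have := DFunLike.congr_fun hnnToSurface_surfaceToHNN z
  rw [MonoidHom.comp_apply, hz1, map_one] at this
  exact this.symm

open QuinticA6A2
open scoped MatrixGroups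

/-! ### The centre of the triangle group -/

theorem eq_smul_of_mk_eq {A B : SL(2, ZMod 7)}
    (h : QuotientGroup.mk' (Subgroup.center SL(2, ZMod 7)) A = QuotientGroup.mk' _ B) :
    ∃ r : ZMod 7, ∀ i j, B i j = A i j * r := by
  obtain ⟨r, -, hr⟩ := Matrix.SpecialLinearGroup.mem_center_iff.1 (QuotientGroup.eq.1 h)
  refine ⟨r, fun i j => ?_⟩
  have : B = A * (A⁻¹ * B) := (mul_inv_cancel_left A B).symm
  rw [this, Matrix.SpecialLinearGroup.coe_mul, ← hr]
  simp [Matrix.scalar_apply]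

theorem coe_matT : (↑matT : Matrix (Fin 2) (Fin 2) (ZMod 7)) = !![1, 1; 0, 1] := rfl

/-- A lift commutes with `matT` and `matS` up to scalars. The first condition makes it upper
triangular with equal diagonal entries, the second then kills the upper right entry. -/
theorem center_psl : Subgroup.center PSL(2, ZMod 7) = ⊥ := by
  refine (Subgroup.eq_bot_iff_forall _).2 fun x hx => ?_
  obtain ⟨A, rfl⟩ := QuotientGroup.mk'_surjective _ x
  have hcomm : ∀ B : SL(2, ZMod 7), ∃ r : ZMod 7, ∀ i j, (A * B) i j = (B * A) i j * r :=
    fun B => eq_smul_of_mk_eq (by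
      rw [map_mul, map_mul]; exact Subgroup.mem_center_iff.1 hx _)
  obtain ⟨r, hr⟩ := hcomm matT
  obtain ⟨s, hs⟩ := hcomm matS
  simp only [Matrix.SpecialLinearGroup.coe_mul, coe_matT, coe_matS, Matrix.mul_apply,
    Fin.sum_univ_two] at hr hs
  have h00 := hr 0 0
  have h01 := hr 0 1
  have h10 := hr 1 0
  have s00 := hs 0 0
  simp at h00 h01 h10 s00
  have hdet := A.det_coe
  rw [Matrix.det_fin_two] at hdet
  have hc : A 1 0 = 0 := by
    by_contra hc
    rw [eq_comm, mul_eq_left₀ hc] at h10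
    rw [h10, mul_one, left_eq_add] at h00
    exact hc h00
  have ha : A 0 0 ≠ 0 := by
    intro ha
    simp [ha, hc] at hdet
  have hr1 : r = 1 := by
    rw [hc, add_zero, eq_comm, mul_eq_left₀ ha] at h00
    exact h00
  have hd : A 0 0 = A 1 1 := by
    rw [hr1, mul_one, add_comm, add_left_cancel_iff] at h01
    exact h01
  refine mk_eq_one_iff.2 ⟨?_, hc, hd⟩
  rw [s00, hc, zero_mul, neg_zero]

theorem center_triangle : Subgroup.center (TriangleGroup 2 3 7) = ⊥ := by
  refine (Subgroup.eq_bot_iff_forall _).2 fun z hz => ?_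
  have hker : z ∈ proj.ker := by
    have : proj z ∈ Subgroup.center PSL(2, ZMod 7) := by
      refine Subgroup.mem_center_iff.2 fun g => ?_
      obtain ⟨g, rfl⟩ := proj_surjective g
      rw [← map_mul, ← map_mul, Subgroup.mem_center_iff.1 hz]
    rwa [center_psl] at this
  let e := kerProjEquiv.trans cyclicEquivSurface
  have : e ⟨z, hker⟩ ∈ Subgroup.center (SurfaceGroup 3) := by
    refine Subgroup.mem_center_iff.2 fun g => ?_
    obtain ⟨g, rfl⟩ := e.surjective g
    rw [← map_mul, ← map_mul]
    exact congrArg e (Subtype.ext (Subgroup.mem_center_iff.1 hz g))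
  rw [center_surface, Subgroup.mem_bot, map_eq_one_iff e e.injective] at this
  exact congrArg Subtype.val this

/-! ### The quotient is the triangle group -/

section Lifts

variable {H : Type*} [Group H]

/-- The homomorphism out of `Pi` determined by two elements satisfying its relations. -/
def piLift (x y : H) (h₁ : x ^ 3 = y ^ 7) (h₂ : y ^ 7 = (x * y ^ 2) ^ 2) : Pi →* H :=
  PresentedGroup.toGroup (f := ![x, y]) (by
    rintro r (rfl | rfl) <;> simpa [mul_inv_eq_one])

@[simp] theorem piLift_u {x y : H} (h₁ : x ^ 3 = y ^ 7) (h₂ : y ^ 7 = (x * y ^ 2) ^ 2) :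
    piLift x y h₁ h₂ u = x := PresentedGroup.toGroup.of _

@[simp] theorem piLift_v {x y : H} (h₁ : x ^ 3 = y ^ 7) (h₂ : y ^ 7 = (x * y ^ 2) ^ 2) :
    piLift x y h₁ h₂ v = y := PresentedGroup.toGroup.of _

/-- The homomorphism out of `PiBar` determined by two elements satisfying its relations. -/
def piBarLift (x y : H) (hx : x ^ 3 = 1) (hy : y ^ 7 = 1) (hxy : (x * y ^ 2) ^ 2 = 1) :
    PiBar →* H :=
  PresentedGroup.toGroup (f := ![x, y]) (by
    rintro r (rfl | rfl | rfl) <;> simpa)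

@[simp] theorem piBarLift_u {x y : H} (hx : x ^ 3 = 1) (hy : y ^ 7 = 1)
    (hxy : (x * y ^ 2) ^ 2 = 1) : piBarLift x y hx hy hxy uBar = x := PresentedGroup.toGroup.of _

@[simp] theorem piBarLift_v {x y : H} (hx : x ^ 3 = 1) (hy : y ^ 7 = 1)
    (hxy : (x * y ^ 2) ^ 2 = 1) : piBarLift x y hx hy hxy vBar = y := PresentedGroup.toGroup.of _

theorem piBar_hom_ext {f g : PiBar →* H} (hu : f uBar = g uBar) (hv : f vBar = g vBar) : f = g :=
  PresentedGroup.ext fun i => by fin_cases i; exacts [hu, hv]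

theorem pi_hom_ext {f g : Pi →* H} (hu : f u = g u) (hv : f v = g v) : f = g :=
  PresentedGroup.ext fun i => by fin_cases i; exacts [hu, hv]

theorem triangle_hom_ext {f g : TriangleGroup 2 3 7 →* H} (ha : f a = g a) (hb : f b = g b) :
    f = g :=
  PresentedGroup.ext fun i => by fin_cases i; exacts [ha, hb]

end Lifts

theorem uBar_pow : uBar ^ 3 = 1 :=
  PresentedGroup.one_of_mem (rels := {FreeGroup.of (0 : Fin 2) ^ 3, FreeGroup.of 1 ^ 7,
    (FreeGroup.of 0 * FreeGroup.of 1 ^ 2) ^ 2}) (by simp)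

theorem vBar_pow : vBar ^ 7 = 1 :=
  PresentedGroup.one_of_mem (rels := {FreeGroup.of (0 : Fin 2) ^ 3, FreeGroup.of 1 ^ 7,
    (FreeGroup.of 0 * FreeGroup.of 1 ^ 2) ^ 2}) (by simp)

theorem uBar_mul_vBar_sq : (uBar * vBar ^ 2) ^ 2 = 1 :=
  PresentedGroup.one_of_mem (rels := {FreeGroup.of (0 : Fin 2) ^ 3, FreeGroup.of 1 ^ 7,
    (FreeGroup.of 0 * FreeGroup.of 1 ^ 2) ^ 2}) (by simp)

theorem mul_eq_inv_of_sq_eq_one {H : Type*} [Group H] {x y : H} (h : (x * y) ^ 2 = 1) :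
    x * y * x = y⁻¹ := by
  refine eq_inv_of_mul_eq_one_left ?_
  rw [← h, sq, mul_assoc _ x y]

theorem uBar_mul_vBar_sq_mul_uBar_pow : (uBar * vBar ^ 2 * uBar) ^ 7 = 1 := by
  rw [mul_eq_inv_of_sq_eq_one uBar_mul_vBar_sq, inv_pow, ← pow_mul, mul_comm 2 7, pow_mul,
    vBar_pow, one_pow, inv_one]

/-- The map from the triangle group to `PiBar`. -/
def triangleToPiBar : TriangleGroup 2 3 7 →* PiBar :=
  TriangleGroup.lift237 (uBar * vBar ^ 2) uBar uBar_mul_vBar_sq uBar_pow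
    uBar_mul_vBar_sq_mul_uBar_pow

/-- Under a = u v² and b = u one gets c = v⁻², hence v = c³; this is the consistency check for that
inverse. -/
theorem b_mul_c_pow : b * (c ^ 3) ^ 2 = a := by
  have h6 : (c ^ 3) ^ 2 = c⁻¹ :=
    eq_inv_of_mul_eq_one_left (by rw [← pow_mul, ← pow_succ, c_pow_seven])
  rw [h6, c, mul_inv_rev, mul_inv_cancel_left, a_inv]

/-- The map from `PiBar` to the triangle group. -/
def piBarToTriangle : PiBar →* TriangleGroup 2 3 7 :=
  piBarLift b (c ^ 3) b_cube
    (by rw [← pow_mul, mul_comm 3 7, pow_mul, c_pow_seven, one_pow])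
    (by rw [b_mul_c_pow, a_sq])

/-- The isomorphism of the triangle group with `PiBar`. -/
def triangleEquivPiBar : TriangleGroup 2 3 7 ≃* PiBar :=
  MonoidHom.toMulEquiv triangleToPiBar piBarToTriangle
    (triangle_hom_ext
      (by
        rw [MonoidHom.comp_apply, triangleToPiBar, lift237_a, map_mul, map_pow, piBarToTriangle,
          piBarLift_u, piBarLift_v, b_mul_c_pow]
        rfl)
      (by rw [MonoidHom.comp_apply, triangleToPiBar, lift237_b, piBarToTriangle, piBarLift_u]
          rfl))
    (piBar_hom_ext
      (by rw [MonoidHom.comp_apply, piBarToTriangle, piBarLift_u, triangleToPiBar, lift237_b]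
          rfl)
      (by
        rw [MonoidHom.comp_apply, piBarToTriangle, piBarLift_v, map_pow, c, map_mul,
          triangleToPiBar, lift237_a, lift237_b, mul_eq_inv_of_sq_eq_one uBar_mul_vBar_sq,
          inv_pow, ← pow_mul]
        exact inv_eq_of_mul_eq_one_left ((pow_succ' vBar 6).symm.trans vBar_pow)))

theorem triangleEquivPiBar_a : triangleEquivPiBar a = uBar * vBar ^ 2 :=
  lift237_a uBar_mul_vBar_sq uBar_pow uBar_mul_vBar_sq_mul_uBar_pow

theorem triangleEquivPiBar_b : triangleEquivPiBar b = uBar :=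
  lift237_b uBar_mul_vBar_sq uBar_pow uBar_mul_vBar_sq_mul_uBar_pow

/-! ### The central extension -/

theorem u_pow_eq : u ^ 3 = v ^ 7 := by
  rw [← mul_inv_eq_one]
  exact PresentedGroup.one_of_mem (rels := {FreeGroup.of (0 : Fin 2) ^ 3 * (FreeGroup.of 1 ^ 7)⁻¹,
      FreeGroup.of 1 ^ 7 * ((FreeGroup.of 0 * FreeGroup.of 1 ^ 2) ^ 2)⁻¹}) (by simp)

theorem v_pow_eq : v ^ 7 = (u * v ^ 2) ^ 2 := by
  rw [← mul_inv_eq_one]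
  exact PresentedGroup.one_of_mem (rels := {FreeGroup.of (0 : Fin 2) ^ 3 * (FreeGroup.of 1 ^ 7)⁻¹,
      FreeGroup.of 1 ^ 7 * ((FreeGroup.of 0 * FreeGroup.of 1 ^ 2) ^ 2)⁻¹}) (by simp)

theorem u_pow_mem_center : u ^ 3 ∈ Subgroup.center Pi := by
  have h : (⊤ : Subgroup Pi) ≤ Subgroup.centralizer {u ^ 3} := by
    rw [← PresentedGroup.closure_range_of, Subgroup.closure_le]
    rintro _ ⟨i, rfl⟩
    rw [SetLike.mem_coe, Subgroup.mem_centralizer_singleton_iff]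
    fin_cases i
    · exact (Commute.pow_right rfl 3 : Commute u (u ^ 3))
    · rw [u_pow_eq]
      exact (Commute.pow_right rfl 7 : Commute v (v ^ 7))
  exact Subgroup.mem_center_iff.2 fun g =>
    Subgroup.mem_centralizer_singleton_iff.1 (h (Subgroup.mem_top g))

/-- The natural projection of `Pi` to `PiBar`. -/
def natProj : Pi →* PiBar :=
  piLift uBar vBar (uBar_pow.trans vBar_pow.symm) (vBar_pow.trans uBar_mul_vBar_sq.symm)

theorem natProj_u : natProj u = uBar := piLift_u ..

theorem natProj_v : natProj v = vBar := piLift_v ..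

theorem natProj_surjective : Function.Surjective natProj := by
  rw [← MonoidHom.range_eq_top, eq_top_iff, ← PresentedGroup.closure_range_of,
    Subgroup.closure_le]
  rintro _ ⟨i, rfl⟩
  fin_cases i
  · exact ⟨u, natProj_u⟩
  · exact ⟨v, natProj_v⟩

instance : (Subgroup.zpowers (u ^ 3)).Normal :=
  ⟨fun n hn g => by
    rw [Subgroup.mem_center_iff.1
      ((Subgroup.zpowers_le.2 u_pow_mem_center : Subgroup.zpowers (u ^ 3) ≤ _) hn) g,
      mul_inv_cancel_right]
    exact hn⟩

/-- The relations of `PiBar` hold in the quotient of `Pi` by the powers of `u ^ 3`, so the quotient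
map factors through `natProj`. -/
theorem ker_natProj : natProj.ker = Subgroup.zpowers (u ^ 3) := by
  have hq : QuotientGroup.mk' (Subgroup.zpowers (u ^ 3)) (u ^ 3) = 1 :=
    (QuotientGroup.eq_one_iff _).2 (Subgroup.mem_zpowers _)
  let σ : PiBar →* Pi ⧸ Subgroup.zpowers (u ^ 3) :=
    piBarLift (QuotientGroup.mk' _ u) (QuotientGroup.mk' _ v) (by rw [← map_pow, hq])
      (by rw [← map_pow, ← u_pow_eq, hq])
      (by rw [← map_pow, ← map_mul, ← map_pow, ← v_pow_eq, ← u_pow_eq, hq])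
  have hσ : σ.comp natProj = QuotientGroup.mk' _ := by
    refine pi_hom_ext ?_ ?_
    · rw [MonoidHom.comp_apply, natProj_u, piBarLift_u]
    · rw [MonoidHom.comp_apply, natProj_v, piBarLift_v]
  refine le_antisymm (fun g hg => ?_) ?_
  · have := DFunLike.congr_fun hσ g
    rw [MonoidHom.comp_apply, MonoidHom.mem_ker.1 hg, map_one, eq_comm] at this
    exact (QuotientGroup.eq_one_iff _).1 this
  · rw [Subgroup.zpowers_le, MonoidHom.mem_ker, map_pow, natProj_u, uBar_pow]

/-! ### Infinite order of `u ^ 3` and the centre of `Pi` -/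

/-- The matrix by which `u` acts in a representation of `Pi` by automorphisms of a Heisenberg
extension of the first homology of the Klein quartic. -/
def matU : Matrix (Fin 8) (Fin 8) ℤ :=
  !![1, 3, 2, -1, -2, -2, -1, 2;
    0, 1, -1, 0, 0, 0, 0, 1;
    0, 1, 0, 0, -1, -1, 0, 0;
    0, 1, 0, 0, 0, 0, -1, -1;
    0, 1, 0, 0, 0, -1, 0, -1;
    0, 1, 0, 0, -1, 0, 0, -1;
    0, 1, 0, 1, 0, -1, -1, -2;
    0, 0, 0, 0, 0, 0, 0, 1]

/-- The matrix by which `v` acts in that representation. -/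
def matV : Matrix (Fin 8) (Fin 8) ℤ :=
  !![1, 0, 0, 0, 0, 0, 0, 3;
    0, 0, 0, -1, 1, 0, 0, 0;
    0, 0, 0, -1, 0, 1, 0, 0;
    0, 0, 0, -1, 0, 0, 1, 0;
    0, 0, 0, -1, 0, 0, 0, 0;
    0, 1, 0, -1, 0, 0, 0, 0;
    0, 0, 1, -1, 0, 0, 0, 0;
    0, 0, 0, 0, 0, 0, 0, 1]

/-- The square of `matV`. -/
def matVSq : Matrix (Fin 8) (Fin 8) ℤ :=
  !![1, 0, 0, 0, 0, 0, 0, 6;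
    0, 0, 0, 0, 0, 0, -1, 0;
    0, 1, 0, 0, 0, 0, -1, 0;
    0, 0, 1, 0, 0, 0, -1, 0;
    0, 0, 0, 1, 0, 0, -1, 0;
    0, 0, 0, 0, 1, 0, -1, 0;
    0, 0, 0, 0, 0, 1, -1, 0;
    0, 0, 0, 0, 0, 0, 0, 1]

theorem matV_sq : matV ^ 2 = matVSq := by rw [sq]; decide +kernel

/-- The matrices are block upper triangular with diagonal blocks of sizes 1, 6, 1. The defining
powers are trivial except for the corner entry 21; what matters is that it is common to all three
and nonzero. -/
theorem matU_pow : matU ^ 3 = Matrix.transvection 0 7 21 := by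
  rw [pow_succ, sq]; decide +kernel

theorem matV_pow : matV ^ 7 = Matrix.transvection 0 7 21 := by
  rw [pow_succ, pow_mul matV 2 3, matV_sq, pow_succ, sq]; decide +kernel

theorem matU_mul_matV_sq : (matU * matV ^ 2) ^ 2 = Matrix.transvection 0 7 21 := by
  rw [matV_sq, sq]; decide +kernel

/-- A matrix with a power that is a transvection is a unit. -/
def unitOfPow (M : Matrix (Fin 8) (Fin 8) ℤ) (n : ℕ)
    (h : M ^ (n + 1) = Matrix.transvection 0 7 21) : (Matrix (Fin 8) (Fin 8) ℤ)ˣ where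
  val := M
  inv := M ^ n * Matrix.transvection 0 7 (-21)
  val_inv := by
    rw [← mul_assoc, ← pow_succ', h, Matrix.transvection_mul_transvection_same _ _ (by decide)]
    simp
  inv_val := by
    rw [mul_eq_one_comm, ← mul_assoc, ← pow_succ', h,
      Matrix.transvection_mul_transvection_same _ _ (by decide)]
    simp

/-- A representation of `Pi` in which `u ^ 3` has infinite order. -/
def heisenbergRep : Pi →* (Matrix (Fin 8) (Fin 8) ℤ)ˣ :=
  piLift (unitOfPow matU 2 matU_pow) (unitOfPow matV 6 matV_pow)
    (Units.ext (matU_pow.trans matV_pow.symm))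
    (Units.ext (matV_pow.trans matU_mul_matV_sq.symm))

theorem transvection_pow (n : ℕ) : (Matrix.transvection 0 7 21 : Matrix (Fin 8) (Fin 8) ℤ) ^ n =
    Matrix.transvection 0 7 ((n : ℤ) * 21) := by
  induction n with
  | zero => simp
  | succ n ih =>
    rw [pow_succ, ih, Matrix.transvection_mul_transvection_same _ _ (by decide)]
    push_cast; ring_nf

theorem zpowersHom_u_pow_injective : Function.Injective (zpowersHom Pi (u ^ 3)) := by
  suffices ¬ IsOfFinOrder (u ^ 3) from injective_zpow_iff_not_isOfFinOrder.2 this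
  rw [isOfFinOrder_iff_pow_eq_one]
  rintro ⟨n, hn, h⟩
  have := congrArg Units.val (congrArg heisenbergRep h)
  rw [map_pow, map_pow, heisenbergRep, piLift_u, Units.val_pow_eq_pow_val,
    Units.val_pow_eq_pow_val] at this
  change (matU ^ 3) ^ n = _ at this
  rw [matU_pow, transvection_pow, map_one, Units.val_one] at this
  have := congrFun (congrFun this 0) 7
  simp [Matrix.transvection] at this
  omega

/-- A surjection carries centre into centre, and the triangle group has trivial centre. -/
theorem center_pi : Subgroup.center Pi = Subgroup.zpowers (u ^ 3) := by
  refine le_antisymm (fun z hz => ?_) (Subgroup.zpowers_le.2 u_pow_mem_center)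
  have : triangleEquivPiBar.symm (natProj z) ∈ Subgroup.center (TriangleGroup 2 3 7) := by
    refine Subgroup.mem_center_iff.2 fun g => ?_
    obtain ⟨g, rfl⟩ := triangleEquivPiBar.symm.surjective g
    obtain ⟨g, rfl⟩ := natProj_surjective g
    rw [← map_mul, ← map_mul, ← map_mul, ← map_mul, Subgroup.mem_center_iff.1 hz]
  rw [center_triangle, Subgroup.mem_bot,
    map_eq_one_iff _ triangleEquivPiBar.symm.injective] at this
  rw [← ker_natProj]
  exact this

/-- The central extension of `PiBar` by the infinite cyclic group generated by `u ^ 3`. -/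
def piExtension : GroupExtension (Multiplicative ℤ) Pi PiBar where
  inl := zpowersHom Pi (u ^ 3)
  rightHom := natProj
  inl_injective := zpowersHom_u_pow_injective
  range_inl_eq_ker_rightHom := by
    rw [ker_natProj]; exact Subgroup.ext fun _ => Iff.rfl
  rightHom_surjective := natProj_surjective

theorem piExtension_isCentral : piExtension.IsCentral := by
  rw [GroupExtension.IsCentral, piExtension.range_inl_eq_ker_rightHom]
  exact (ker_natProj.trans center_pi.symm).le

/-! ### Restriction of the extension to the surface group -/

/-- The restriction of a group extension of `Q` to the preimage of a subgroup of a group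
isomorphic to `Q`. -/
def restrictExtension {N E G Q : Type*} [Group N] [Group E] [Group G] [Group Q]
    (S : GroupExtension N E Q) (φ : G ≃* Q) (K : Subgroup G) :
    GroupExtension N (K.comap (φ.symm.toMonoidHom.comp S.rightHom)) K where
  inl := S.inl.codRestrict _ fun n => by simp [Subgroup.mem_comap, K.one_mem]
  rightHom := (φ.symm.toMonoidHom.comp S.rightHom).subgroupComap K
  inl_injective := fun x y h => S.inl_injective (congrArg Subtype.val h)
  range_inl_eq_ker_rightHom := by
    ext x
    have h : x.1 ∈ S.inl.range ↔ x.1 ∈ S.rightHom.ker := by rw [S.range_inl_eq_ker_rightHom]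
    rw [MonoidHom.mem_ker] at h ⊢
    rw [Subtype.ext_iff]
    change _ ↔ φ.symm (S.rightHom x.1) = 1
    rw [map_eq_one_iff _ φ.symm.injective, ← h]
    exact ⟨fun ⟨n, hn⟩ => ⟨n, congrArg Subtype.val hn⟩, fun ⟨n, hn⟩ => ⟨n, Subtype.ext hn⟩⟩
  rightHom_surjective := MonoidHom.subgroupComap_surjective_of_surjective _ _
    (φ.symm.surjective.comp S.rightHom_surjective)

theorem restrictExtension_isCentral {N E G Q : Type*} [Group N] [Group E] [Group G] [Group Q]
    {S : GroupExtension N E Q} (hS : S.IsCentral) (φ : G ≃* Q) (K : Subgroup G) :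
    (restrictExtension S φ K).IsCentral := by
  rintro _ ⟨n, rfl⟩
  exact Subgroup.mem_center_iff.2 fun g =>
    Subtype.ext (Subgroup.mem_center_iff.1 (hS ⟨n, rfl⟩) g.1)

/-- The extension obtained by identifying the quotient with an isomorphic group. -/
def extensionCongr {N E G Q : Type*} [Group N] [Group E] [Group G] [Group Q]
    (S : GroupExtension N E Q) (e : Q ≃* G) : GroupExtension N E G where
  inl := S.inl
  rightHom := e.toMonoidHom.comp S.rightHom
  inl_injective := S.inl_injective
  range_inl_eq_ker_rightHom := by
    rw [S.range_inl_eq_ker_rightHom]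
    ext x
    simp [MonoidHom.mem_ker]
  rightHom_surjective := e.surjective.comp S.rightHom_surjective

end KleinQuartic

theorem mainTheorem4 :
    IsVirtuallyZCentralExtension QuinticA6A2.Pi (SurfaceGroup 3) ∧
    ∃ (S : GroupExtension (Multiplicative ℤ) QuinticA6A2.Pi QuinticA6A2.PiBar)
      (φ : TriangleGroup 2 3 7 ≃* QuinticA6A2.PiBar)
      (f : TriangleGroup 2 3 7 →*
        Matrix.ProjectiveSpecialLinearGroup (Fin 2) (ZMod 7)),
      -- the natural projection is a central extension with kernel `ℤ`, generated by `u ^ 3`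
      S.IsCentral ∧
      S.inl (Multiplicative.ofAdd 1) = QuinticA6A2.u ^ 3 ∧
      S.rightHom QuinticA6A2.u = QuinticA6A2.uBar ∧
      S.rightHom QuinticA6A2.v = QuinticA6A2.vBar ∧
      -- the centre is generated by `u ^ 3`
      Subgroup.center QuinticA6A2.Pi = Subgroup.zpowers (QuinticA6A2.u ^ 3) ∧
      -- the quotient is the `(2,3,7)` triangle group
      φ QuinticA6A2.a = QuinticA6A2.uBar * QuinticA6A2.vBar ^ 2 ∧
      φ QuinticA6A2.b = QuinticA6A2.uBar ∧
      -- the triangle group maps onto `PSL(2,7)` with kernel the genus-3 surface group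
      Function.Surjective f ∧
      Nonempty (f.ker ≃* SurfaceGroup 3) ∧
      -- the preimage of that kernel has finite index and, by restriction of the projection,
      -- is a `ℤ`-central extension of `f.ker`, hence of the genus-3 surface group
      (f.ker.comap (φ.symm.toMonoidHom.comp S.rightHom)).FiniteIndex ∧
      ∃ S' : GroupExtension (Multiplicative ℤ)
          (f.ker.comap (φ.symm.toMonoidHom.comp S.rightHom)) f.ker,
        S'.IsCentral ∧
        (∀ n, (S'.inl n : QuinticA6A2.Pi) = S.inl n) ∧
        (∀ x, (S'.rightHom x : TriangleGroup 2 3 7) =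
          φ.symm (S.rightHom (x : QuinticA6A2.Pi))) := by
  have hfin : (KleinQuartic.proj.ker.comap (KleinQuartic.triangleEquivPiBar.symm.toMonoidHom.comp
      KleinQuartic.piExtension.rightHom)).FiniteIndex := by
    rw [MonoidHom.comap_ker]
    exact Subgroup.finiteIndex_ker _
  have hcent := KleinQuartic.restrictExtension_isCentral KleinQuartic.piExtension_isCentral
    KleinQuartic.triangleEquivPiBar KleinQuartic.proj.ker
  let e := KleinQuartic.kerProjEquiv.trans KleinQuartic.cyclicEquivSurface
  -- Centrality concerns `inl` alone, so `hcent` survives the change of quotient along `e`.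
  refine ⟨⟨_, hfin, KleinQuartic.extensionCongr (KleinQuartic.restrictExtension _ _ _) e, hcent⟩,
    KleinQuartic.piExtension, KleinQuartic.triangleEquivPiBar, KleinQuartic.proj,
    KleinQuartic.piExtension_isCentral, ?_, KleinQuartic.natProj_u, KleinQuartic.natProj_v,
    KleinQuartic.center_pi, KleinQuartic.triangleEquivPiBar_a, KleinQuartic.triangleEquivPiBar_b,
    KleinQuartic.proj_surjective, ⟨e⟩, hfin,
    KleinQuartic.restrictExtension _ _ _, hcent, fun _ => rfl, fun _ => rfl⟩
  exact zpow_one (QuinticA6A2.u ^ 3)
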